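/- Let $d\ge 0$ be an integer and $\alpha>-1/2$. Write $\mathbb{R}^{d+1}_+=\mathbb{R}^d\times(0,\infty)$, $x=(x',x_{d+1})$, and $$d\mu_\alpha(x)=\frac{x_{d+1}^{2\alpha+1}}{(2\pi)^d2^{2\alpha}\Gamma(\alpha+1)^2}\,dx,\qquad L^p_\alpha(\mathbb{R}^{d+1}_+)=L^p(\mathbb{R}^{d+1}_+,\mu_\alpha)\ \text{(complex valued)},\qquad \langle f,g\rangle_{\alpha,2}=\int_{\mathbb{R}^{d+1}_+} f\,\overline{g}\,d\mu_\alpha .$$ Let $j_\alpha(t)=\Gamma(\alpha+1)\sum_{k\ge0}\frac{(-1)^k (t/2)^{2k}}{k!\,\Gamma(\alpha+k+1)}$. The Weinstein transform of $u\in L^1_\alpha(\mathbb{R}^{d+1}_+)$ is $$\mathcal F_W(u)(\xi)=\int_{\mathbb{R}^{d+1}_+}u(x)\,e^{-i\langle x',\xi'\rangle}j_\alpha(x_{d+1}\xi_{d+1})\,d\mu_\alpha(x),$$ and $\mathcal F_W$ on $L^2_\alpha(\mathbb{R}^{d+1}_+)$ is its continuous extension from $L^1_\alpha\cap L^2_\alpha$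 (with values in $L^2_\alpha$). For $a>0$ and $x,y\in\mathbb{R}^{d+1}_+$ put $\varphi_a(y)=a^{-(2\alpha+d+2)}\varphi(y/a)$, $$\tau^\alpha_xu(y)=\frac{\Gamma(\alpha+1)}{\sqrt\pi\,\Gamma(\alpha+\frac12)}\int_0^\pi u\Big(x'+y',\sqrt{x_{d+1}^2+y_{d+1}^2+2x_{d+1}y_{d+1}\cos\theta}\Big)(\sin\theta)^{2\alpha}\,d\theta ,$$ $$\varphi_{a,x}=a^{\alpha+1+\frac d2}\,\tau^\alpha_x\varphi_a,\qquad \Phi^W_\varphi(f)(a,x)=\int_{\mathbb{R}^{d+1}_+}f(y)\,\overline{\varphi_{a,x}(y)}\,d\mu_\alpha(y).$$ On $\mathbb X=(0,\infty)\times\mathbb{R}^{d+1}_+$ let $d\mu_\alpha(a,x)=a^{-(2\alpha+d+3)}\,d\mu_\alpha(x)\,da$. A function $\varphi\in L^2_\alpha(\mathbb{R}^{d+1}_+)$ is a Weinstein wavelet if there is a constant $0<C_\varphi<\infty$ with $\int_0^\infty|\mathcal F_W(\varphi)(a\xi)|^2\frac{da}a=C_\varphi$ for almost all $\xi$. A pair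 $(\varphi,\psi)$ in $L^2_\alpha(\mathbb{R}^{d+1}_+)$ is a Weinstein two-wavelet with constant $C_{\varphi,\psi}\in\mathbb C$ if, for almost all $\xi\in\mathbb{R}^{d+1}_+$, the integral $\int_0^\infty\mathcal F_W(\psi)(a\xi)\,\overline{\mathcal F_W(\varphi)(a\xi)}\,\frac{da}a$ converges absolutely and equals $C_{\varphi,\psi}$. **Theorem.** Let $\varphi$ and $\psi$ be Weinstein wavelets such that $(\varphi,\psi)$ is a Weinstein two-wavelet. Then for all $f,g\in L^2_\alpha(\mathbb{R}^{d+1}_+)$ the function $\Phi^W_\varphi(f)\,\overline{\Phi^W_\psi(g)}$ is integrable on $\mathbb X$ with respect to $\mu_\alpha$, and $$\int_{\mathbb X}\Phi^W_\varphi(f)(a,x)\,\overline{\Phi^W_\psi(g)(a,x)}\,d\mu_\alpha(a,x)=C_{\varphi,\psi}\,\langle f,g\rangle_{\alpha,2}.$$ -/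

import Mathlib

open MeasureTheory Set Filter Topology ComplexConjugate

noncomputable section

namespace Weinstein

/-- The space `ℝ^{d+1} = ℝ^d × ℝ`, whose points are written `x = (x', x_{d+1}) = (x.1, x.2)`. -/
abbrev Space (d : ℕ) : Type := EuclideanSpace ℝ (Fin d) × ℝ

/-- The open half-space `ℝ^{d+1}_+ = ℝ^d × (0, ∞)`. -/
def halfSpace (d : ℕ) : Set (Space d) := {x | 0 < x.2}

/-- The measure `dμ_α(x) = x_{d+1}^{2α+1} / ((2π)^d 2^{2α} Γ(α+1)²) dx`, carried by the half-space.
Functions on the half-space are total functions on `Space d`, and `L^p_α` is `MemLp · p (μ d α)`. -/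
def μ (d : ℕ) (α : ℝ) : Measure (Space d) :=
  (volume.restrict (halfSpace d)).withDensity fun x =>
    ENNReal.ofReal (x.2 ^ (2 * α + 1) /
      ((2 * Real.pi) ^ d * (2 : ℝ) ^ (2 * α) * Real.Gamma (α + 1) ^ 2))

/-- The normalized Bessel function
`j_α(t) = Γ(α+1) ∑_k (-1)^k (t/2)^{2k} / (k! Γ(α+k+1))`. It is the even solution of
`u'' + (2α+1)/t u' = -u` with `u(0) = 1`. -/
def besselJ (α t : ℝ) : ℝ :=
  Real.Gamma (α + 1) * ∑' k : ℕ,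
    (-1) ^ k * (t / 2) ^ (2 * k) / ((k.factorial : ℝ) * Real.Gamma (α + k + 1))

/-- The Weinstein kernel `Λ(x, ξ) = exp(-i ⟨x', ξ'⟩) j_α(x_{d+1} ξ_{d+1})`. -/
def kernel {d : ℕ} (α : ℝ) (x ξ : Space d) : ℂ :=
  Complex.exp (-Complex.I * ((inner ℝ x.1 ξ.1 : ℝ) : ℂ)) * ((besselJ α (x.2 * ξ.2) : ℝ) : ℂ)

/-- The Weinstein transform of an integrable function, `∫ u(x) Λ(x, ξ) dμ_α(x)`. -/
def fourierIntegral {d : ℕ} (α : ℝ) (u : Space d → ℂ) (ξ : Space d) : ℂ :=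
  ∫ x, u x * kernel α x ξ ∂(μ d α)

/-- `h` is a Weinstein transform of `u ∈ L²_α`: the `L²_α`-limit of the transforms of some sequence
in `L¹_α ∩ L²_α` that converges to `u` in `L²_α`. This is the extension of the transform by
continuity from `L¹_α ∩ L²_α` to `L²_α`; it determines `h` almost everywhere. -/
def IsTransform {d : ℕ} (α : ℝ) (u h : Space d → ℂ) : Prop :=
  MemLp u 2 (μ d α) ∧ MemLp h 2 (μ d α) ∧
    ∃ v : ℕ → Space d → ℂ,
      (∀ n, MemLp (v n) 1 (μ d α) ∧ MemLp (v n) 2 (μ d α)) ∧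
      Tendsto (fun n => eLpNorm (v n - u) 2 (μ d α)) atTop (𝓝 0) ∧
      Tendsto (fun n => eLpNorm (fourierIntegral α (v n) - h) 2 (μ d α)) atTop (𝓝 0)

open Classical in
/-- The Weinstein transform `F_W` on `L²_α` (a representative of it). -/
def transform {d : ℕ} (α : ℝ) (u : Space d → ℂ) : Space d → ℂ :=
  if h : ∃ h, IsTransform α u h then h.choose else 0

/-- The generalized translation
`τ_x u(y) = C_α ∫_0^π u(x' + y', √(x_{d+1}² + y_{d+1}² + 2 x_{d+1} y_{d+1} cos θ)) (sin θ)^{2α} dθ`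
with `C_α = Γ(α+1) / (√π Γ(α+1/2))`. -/
def translation {d : ℕ} (α : ℝ) (x : Space d) (u : Space d → ℂ) (y : Space d) : ℂ :=
  ((Real.Gamma (α + 1) / (√Real.pi * Real.Gamma (α + 1 / 2)) : ℝ) : ℂ) *
    ∫ θ in Ioo (0 : ℝ) Real.pi,
      u (x.1 + y.1, √(x.2 ^ 2 + y.2 ^ 2 + 2 * x.2 * y.2 * Real.cos θ)) *
        ((Real.sin θ ^ (2 * α) : ℝ) : ℂ)

/-- The dilate `φ_a(x) = a^{-(2α+d+2)} φ(x/a)`. -/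
def dilate {d : ℕ} (α a : ℝ) (φ : Space d → ℂ) (x : Space d) : ℂ :=
  ((1 / a ^ (2 * α + d + 2) : ℝ) : ℂ) * φ (a⁻¹ • x)

/-- The family `φ_{a,x}(y) = a^{α+1+d/2} τ_x φ_a(y)`. -/
def waveletFamily {d : ℕ} (α : ℝ) (φ : Space d → ℂ) (a : ℝ) (x y : Space d) : ℂ :=
  ((a ^ (α + 1 + (d : ℝ) / 2) : ℝ) : ℂ) * translation α x (dilate α a φ) y

/-- The Weinstein continuous wavelet transform
`Φ_φ(f)(a, x) = ∫ f(y) conj(φ_{a,x}(y)) dμ_α(y)`. -/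
def waveletTransform {d : ℕ} (α : ℝ) (φ f : Space d → ℂ) (p : ℝ × Space d) : ℂ :=
  ∫ y, f y * conj (waveletFamily α φ p.1 p.2 y) ∂(μ d α)

/-- The measure `dμ_α(a, x) = dμ_α(x) da / a^{2α+d+3}` on `(0, ∞) × ℝ^{d+1}_+`. -/
def μX (d : ℕ) (α : ℝ) : Measure (ℝ × Space d) :=
  ((volume.restrict (Ioi (0 : ℝ))).withDensity fun a =>
    ENNReal.ofReal (1 / a ^ (2 * α + d + 3))).prod (μ d α)

/-- `φ ∈ L²_α` is a Weinstein wavelet: there is a constant `0 < C_φ < ∞` with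
`∫_0^∞ |F_W(φ)(aξ)|² da/a = C_φ` for almost all `ξ`. -/
def IsWavelet {d : ℕ} (α : ℝ) (φ : Space d → ℂ) : Prop :=
  MemLp φ 2 (μ d α) ∧ ∃ C : ℝ, 0 < C ∧ ∀ᵐ ξ ∂(μ d α),
    ∫⁻ a in Ioi (0 : ℝ), ENNReal.ofReal (‖transform α φ (a • ξ)‖ ^ 2 / a) = ENNReal.ofReal C

/-- `(φ, ψ)` is a Weinstein two-wavelet with constant `C = C_{φ,ψ}`: both functions are in `L²_α`,
and `∫_0^∞ F_W(ψ)(aξ) conj(F_W(φ)(aξ)) da/a` exists and equals `C` for almost all `ξ`. -/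
def IsTwoWavelet {d : ℕ} (α : ℝ) (φ ψ : Space d → ℂ) (C : ℂ) : Prop :=
  MemLp φ 2 (μ d α) ∧ MemLp ψ 2 (μ d α) ∧ ∀ᵐ ξ ∂(μ d α),
    IntegrableOn (fun a : ℝ => transform α ψ (a • ξ) * conj (transform α φ (a • ξ)) / (a : ℂ))
      (Ioi 0) ∧
    ∫ a in Ioi (0 : ℝ), transform α ψ (a • ξ) * conj (transform α φ (a • ξ)) / (a : ℂ) = C

end Weinstein

end

noncomputable section

namespace Weinstein

/-! Write F for the Weinstein transform, Λ for `kernel` and K for `normConst d α`. Two facts carry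
the theorem. The first is Parseval, ⟨Fu, Fv⟩ = K⟨u, v⟩ (`inner_transformL2`, `parseval`). The factor
K appears because the normalization of μ does not make F unitary. The second is the convolution
theorem K ∫ f conj(τ_x u) dμ = ∫ Ff conj(Fu) Λ(x, ·) dμ on L²
(`normConst_mul_integral_mul_conj_translate`).

Take u to be the dilate φ_a, whose transform is Fφ(aξ). Then x ↦ Φ_φ(f)(a, x) is a^{D/2}/K times the
transform of the symbol Ff(ξ) conj(Fφ(aξ)), where D is `homDim d α` (`waveletTransform_eq`). In the
product of two wavelet transforms the powers of a cancel against the weight and leave da/a. Parseval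
in x for each fixed a, Fubini with the a-integral done first, and Parseval once more give C⟨f, g⟩.
The constants multiply to K⁻² · K · K = 1. The wavelet condition puts each symbol in L² of da/a × μ,
which gives integrability and justifies Fubini (`memLp_waveletSymbol`).

Both facts are obtained by explicit computation on Gaussians modulated in x'. The Poisson integral
of j_α yields one Hankel formula for complex frequencies. Imaginary frequencies give transforms, and
real ones give generalized translates. A Stone–Weierstrass argument shows that measures on the
half-space are determined by Gaussian integrals (`measure_ext_of_gauss`). Hence Gaussians span a
dense subspace of L², and the map underlying the translation preserves measure, so correlations with
translates are continuous on L². The identities therefore extend from Gaussians to L². -/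

/-! ### The angular probability measure. -/

/-- The normalizing constant of the generalized translation. -/
def angleConst (α : ℝ) : ℝ := Real.Gamma (α + 1) / (√Real.pi * Real.Gamma (α + 1 / 2))

/-- The probability measure `C_α (sin θ)^{2α} dθ` on `(0, π)`. -/
def angleMeasure (α : ℝ) : Measure ℝ :=
  (volume.restrict (Ioo 0 Real.pi)).withDensity fun θ =>
    ENNReal.ofReal (angleConst α * Real.sin θ ^ (2 * α))

lemma angleConst_pos {α : ℝ} (hα : -(1 / 2) < α) : 0 < angleConst α := by
  have h1 : 0 < Real.Gamma (α + 1) := Real.Gamma_pos_of_pos (by linarith)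
  have h2 : 0 < Real.Gamma (α + 1 / 2) := Real.Gamma_pos_of_pos (by linarith)
  have := Real.pi_pos
  unfold angleConst
  positivity

lemma image_half_one_sub_cos :
    (fun θ : ℝ => (1 - Real.cos θ) / 2) '' Ioo 0 Real.pi = Ioo 0 1 := by
  ext u
  constructor
  · rintro ⟨θ, ⟨h0, h1⟩, rfl⟩
    have ha : Real.cos θ < 1 := by
      simpa using Real.cos_lt_cos_of_nonneg_of_le_pi le_rfl h1.le h0
    have hb : -1 < Real.cos θ := by
      simpa using Real.cos_lt_cos_of_nonneg_of_le_pi h0.le le_rfl h1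
    constructor <;> dsimp only <;> linarith
  · rintro ⟨h0, h1⟩
    refine ⟨Real.arccos (1 - 2 * u), ⟨?_, ?_⟩, ?_⟩
    · exact Real.arccos_pos.2 (by linarith)
    · refine lt_of_le_of_ne (Real.arccos_le_pi _) fun h => ?_
      rw [Real.arccos_eq_pi] at h
      linarith
    · dsimp only
      rw [Real.cos_arccos (by linarith) (by linarith)]
      ring

/-- The substitution u = (1 - cos θ)/2 has u(1 - u) = (sin θ / 2)², so it carries the symmetric Beta
density to a power of sin θ. Legendre's duplication formula matches the constants. -/
lemma angle_density_eq {α : ℝ} (hα : -(1 / 2) < α) {θ : ℝ} (hθ : θ ∈ Ioo 0 Real.pi) :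
    |Real.sin θ / 2| * (1 / ProbabilityTheory.beta (α + 1 / 2) (α + 1 / 2) *
      ((1 - Real.cos θ) / 2) ^ (α + 1 / 2 - 1) *
        (1 - (1 - Real.cos θ) / 2) ^ (α + 1 / 2 - 1)) =
    angleConst α * Real.sin θ ^ (2 * α) := by
  have hs : 0 < Real.sin θ := Real.sin_pos_of_pos_of_lt_pi hθ.1 hθ.2
  have ha : Real.cos θ < 1 := by
    simpa using Real.cos_lt_cos_of_nonneg_of_le_pi le_rfl hθ.2.le hθ.1
  have hb : -1 < Real.cos θ := by
    simpa using Real.cos_lt_cos_of_nonneg_of_le_pi hθ.1.le le_rfl hθ.2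
  rw [mul_assoc (1 / _), ← Real.mul_rpow (by linarith) (by linarith)]
  have h1 : (1 - Real.cos θ) / 2 * (1 - (1 - Real.cos θ) / 2) = (Real.sin θ / 2) ^ (2 : ℝ) := by
    rw [Real.rpow_two]
    nlinarith [Real.sin_sq_add_cos_sq θ]
  rw [h1, ← Real.rpow_mul (by positivity), abs_of_pos (by positivity)]
  have h2 : Real.sin θ / 2 * (Real.sin θ / 2) ^ (2 * (α + 1 / 2 - 1)) =
      (Real.sin θ / 2) ^ (2 * α) := by
    nth_rw 1 [← Real.rpow_one (Real.sin θ / 2)]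
    rw [← Real.rpow_add (by positivity)]
    congr 1
    ring
  rw [mul_left_comm, h2, Real.div_rpow hs.le (by norm_num)]
  have hd := Real.Gamma_mul_Gamma_add_half (α + 1 / 2)
  have e1 : α + 1 / 2 + 1 / 2 = α + 1 := by ring
  have e2 : (2 : ℝ) ^ (1 - 2 * (α + 1 / 2)) = ((2 : ℝ) ^ (2 * α))⁻¹ := by
    rw [← Real.rpow_neg (by norm_num)]; congr 1; ring
  rw [e1, e2] at hd
  have g1 : 0 < Real.Gamma (α + 1) := Real.Gamma_pos_of_pos (by linarith)
  have g2 : 0 < Real.Gamma (α + 1 / 2) := Real.Gamma_pos_of_pos (by linarith)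
  have g3 : 0 < Real.Gamma (2 * (α + 1 / 2)) := Real.Gamma_pos_of_pos (by linarith)
  have hp : 0 < √Real.pi := Real.sqrt_pos.2 Real.pi_pos
  have h3 : (0 : ℝ) < 2 ^ (2 * α) := by positivity
  have e3 : α + 1 / 2 + (α + 1 / 2) = 2 * (α + 1 / 2) := by ring
  rw [ProbabilityTheory.beta, angleConst, e3]
  generalize Real.Gamma (α + 1) = A at *
  generalize Real.Gamma (α + 1 / 2) = B at *
  generalize Real.Gamma (2 * (α + 1 / 2)) = D at *
  generalize √Real.pi = P at *
  generalize (2 : ℝ) ^ (2 * α) = Q at *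
  field_simp at hd ⊢
  linear_combination -hd

lemma lintegral_angle_density {α : ℝ} (hα : -(1 / 2) < α) :
    ∫⁻ θ in Ioo 0 Real.pi, ENNReal.ofReal (angleConst α * Real.sin θ ^ (2 * α)) = 1 := by
  have hp : 0 < α + 1 / 2 := by linarith
  have h := lintegral_image_eq_lintegral_abs_deriv_mul (s := Ioo 0 Real.pi)
    (f := fun θ : ℝ => (1 - Real.cos θ) / 2) (f' := fun θ => Real.sin θ / 2) measurableSet_Ioo
    (fun θ _ => by
      simpa using (((Real.hasDerivAt_cos θ).const_sub 1).div_const 2).hasDerivWithinAt)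
    (fun x hx y hy h => by
      have : Real.cos x = Real.cos y := by
        have : (1 - Real.cos x) / 2 = (1 - Real.cos y) / 2 := h
        linarith
      exact Real.injOn_cos (Ioo_subset_Icc_self hx) (Ioo_subset_Icc_self hy) this)
    (fun x => ENNReal.ofReal (1 / ProbabilityTheory.beta (α + 1 / 2) (α + 1 / 2) *
      x ^ (α + 1 / 2 - 1) * (1 - x) ^ (α + 1 / 2 - 1)))
  rw [image_half_one_sub_cos, ← ProbabilityTheory.lintegral_betaPDF,
    ProbabilityTheory.lintegral_betaPDF_eq_one hp hp] at h
  rw [h]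
  refine setLIntegral_congr_fun measurableSet_Ioo fun θ hθ => ?_
  rw [← ENNReal.ofReal_mul (abs_nonneg _), angle_density_eq hα hθ]

lemma isProbabilityMeasure_angleMeasure {α : ℝ} (hα : -(1 / 2) < α) :
    IsProbabilityMeasure (angleMeasure α) := by
  constructor
  rw [angleMeasure, withDensity_apply _ MeasurableSet.univ, Measure.restrict_univ]
  exact lintegral_angle_density hα

lemma integral_angleMeasure {α : ℝ} (hα : -(1 / 2) < α) (f : ℝ → ℂ) :
    ∫ θ, f θ ∂(angleMeasure α) = ((angleConst α : ℝ) : ℂ) *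
      ∫ θ in Ioo 0 Real.pi, f θ * ((Real.sin θ ^ (2 * α) : ℝ) : ℂ) := by
  rw [angleMeasure, integral_withDensity_eq_integral_toReal_smul (by fun_prop) (by simp),
    ← integral_const_mul]
  refine setIntegral_congr_fun measurableSet_Ioo fun θ hθ => ?_
  have hs : 0 < Real.sin θ := Real.sin_pos_of_pos_of_lt_pi hθ.1 hθ.2
  have := angleConst_pos hα
  rw [ENNReal.toReal_ofReal (by positivity), Complex.real_smul]
  push_cast
  ring

lemma integrableOn_sin_rpow {α : ℝ} (hα : -(1 / 2) < α) :
    IntegrableOn (fun θ => Real.sin θ ^ (2 * α)) (Ioo 0 Real.pi) := by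
  have h : IntegrableOn (fun θ => angleConst α * Real.sin θ ^ (2 * α)) (Ioo 0 Real.pi) := by
    refine ⟨(by fun_prop : Measurable _).aestronglyMeasurable, ?_⟩
    rw [hasFiniteIntegral_iff_ofReal]
    · rw [lintegral_angle_density hα]; exact ENNReal.one_lt_top
    · refine (ae_restrict_mem measurableSet_Ioo).mono fun θ hθ => ?_
      have hs : 0 < Real.sin θ := Real.sin_pos_of_pos_of_lt_pi hθ.1 hθ.2
      have := angleConst_pos hα
      simp only [Pi.zero_apply]
      positivity
  have := h.const_mul (angleConst α)⁻¹
  refine this.congr (ae_of_all _ fun θ => ?_)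
  dsimp only
  rw [inv_mul_cancel_left₀ (angleConst_pos hα).ne']

/-! ### Cosine moments and the Poisson integral of the Bessel function. -/

/-- The integral of `cos^m sin^{2α}` over `(0, π)`. -/
def cosMoment (α : ℝ) (m : ℕ) : ℝ :=
  ∫ θ in Ioo 0 Real.pi, Real.cos θ ^ m * Real.sin θ ^ (2 * α)

lemma integrableOn_cos_pow {α : ℝ} (hα : -(1 / 2) < α) (m : ℕ) :
    IntegrableOn (fun θ => Real.cos θ ^ m * Real.sin θ ^ (2 * α)) (Ioo 0 Real.pi) := by
  refine (integrableOn_sin_rpow hα).bdd_mul (c := 1)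
    (by fun_prop : Measurable _).aestronglyMeasurable (ae_of_all _ fun θ => ?_)
  rw [norm_pow, Real.norm_eq_abs]
  exact pow_le_one₀ (abs_nonneg _) (Real.abs_cos_le_one θ)

/-- The boundary terms vanish because 2α + 1 > 0, so the power of the sine is continuous and zero at
both endpoints. -/
lemma integral_deriv_cos_pow {α : ℝ} (hα : -(1 / 2) < α) (m : ℕ) {f' : ℝ → ℝ}
    (hd : ∀ θ ∈ Ioo 0 Real.pi, HasDerivAt
      (fun θ => Real.cos θ ^ m * Real.sin θ ^ (2 * α + 1)) (f' θ) θ)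
    (hi : IntegrableOn f' (Ioo 0 Real.pi)) : ∫ θ in Ioo 0 Real.pi, f' θ = 0 := by
  rw [← integral_Ioc_eq_integral_Ioo, ← intervalIntegral.integral_of_le Real.pi_pos.le,
    intervalIntegral.integral_eq_sub_of_hasDerivAt_of_le Real.pi_pos.le
      (f := fun θ => Real.cos θ ^ m * Real.sin θ ^ (2 * α + 1)) ?_ hd ?_]
  · have h : 2 * α + 1 ≠ 0 := by linarith
    simp [Real.zero_rpow h]
  · refine Continuous.continuousOn (Continuous.mul (by fun_prop) ?_)
    exact Real.continuous_sin.rpow_const fun _ => Or.inr (by linarith)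
  · rwa [intervalIntegrable_iff_integrableOn_Ioo_of_le Real.pi_pos.le]

lemma hasDerivAt_sin_rpow {α θ : ℝ} (hθ : θ ∈ Ioo 0 Real.pi) :
    HasDerivAt (fun θ => Real.sin θ ^ (2 * α + 1))
      ((2 * α + 1) * Real.cos θ * Real.sin θ ^ (2 * α)) θ := by
  have hs : 0 < Real.sin θ := Real.sin_pos_of_pos_of_lt_pi hθ.1 hθ.2
  convert! (Real.hasDerivAt_sin θ).rpow_const (p := 2 * α + 1) (Or.inl hs.ne') using 1
  rw [add_sub_cancel_right]
  ring

lemma cosMoment_one {α : ℝ} (hα : -(1 / 2) < α) : cosMoment α 1 = 0 := by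
  have h := integral_deriv_cos_pow hα 0
    (f' := fun θ => (2 * α + 1) * (Real.cos θ ^ 1 * Real.sin θ ^ (2 * α)))
    (fun θ hθ => by simpa [mul_assoc] using hasDerivAt_sin_rpow (α := α) hθ)
    ((integrableOn_cos_pow hα 1).const_mul _)
  rw [integral_const_mul] at h
  exact (mul_eq_zero.1 h).resolve_left (by linarith)

/-- Integrate the derivative of cos^{m+1} sin^{2α+1}, after replacing sin² by 1 - cos². -/
lemma cosMoment_add_two {α : ℝ} (hα : -(1 / 2) < α) (m : ℕ) :
    (m + 2 + 2 * α) * cosMoment α (m + 2) = (m + 1) * cosMoment α m := by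
  have h := integral_deriv_cos_pow hα (m + 1)
    (f' := fun θ => (m + 2 + 2 * α) * (Real.cos θ ^ (m + 2) * Real.sin θ ^ (2 * α)) -
      (m + 1) * (Real.cos θ ^ m * Real.sin θ ^ (2 * α)))
    (fun θ hθ => by
      have hs : 0 < Real.sin θ := Real.sin_pos_of_pos_of_lt_pi hθ.1 hθ.2
      convert! ((Real.hasDerivAt_cos θ).fun_pow (m + 1)).mul (hasDerivAt_sin_rpow (α := α) hθ)
        using 1
      rw [Real.rpow_add_one hs.ne', Nat.add_sub_cancel]
      push_cast
      linear_combination ((m : ℝ) + 1) * Real.cos θ ^ m * Real.sin θ ^ (2 * α) *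
        Real.sin_sq_add_cos_sq θ)
    (((integrableOn_cos_pow hα _).const_mul _).sub ((integrableOn_cos_pow hα _).const_mul _))
  rw [integral_sub ((integrableOn_cos_pow hα _).const_mul _)
    ((integrableOn_cos_pow hα _).const_mul _), integral_const_mul, integral_const_mul] at h
  exact sub_eq_zero.1 h

lemma cosMoment_odd {α : ℝ} (hα : -(1 / 2) < α) (k : ℕ) : cosMoment α (2 * k + 1) = 0 := by
  induction k with
  | zero => exact cosMoment_one hα
  | succ k ih =>
    have h := cosMoment_add_two hα (2 * k + 1)
    rw [ih, mul_zero] at h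
    refine (mul_eq_zero.1 h).resolve_left ?_
    push_cast
    have : (0 : ℝ) ≤ k := k.cast_nonneg
    linarith

lemma angleConst_mul_cosMoment_zero {α : ℝ} (hα : -(1 / 2) < α) :
    angleConst α * cosMoment α 0 = 1 := by
  have := isProbabilityMeasure_angleMeasure hα
  have h := integral_angleMeasure hα fun _ => 1
  simp only [integral_const, probReal_univ, one_smul, one_mul] at h
  rw [integral_complex_ofReal] at h
  simp only [cosMoment, pow_zero, one_mul]
  exact_mod_cast h.symm

lemma angleConst_mul_cosMoment_even {α : ℝ} (hα : -(1 / 2) < α) (k : ℕ) :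
    angleConst α * cosMoment α (2 * k) = Real.Gamma (α + 1) * (2 * k).factorial /
      (4 ^ k * k.factorial * Real.Gamma (α + k + 1)) := by
  induction k with
  | zero =>
    have : Real.Gamma (α + 1) ≠ 0 := (Real.Gamma_pos_of_pos (by linarith)).ne'
    simp [angleConst_mul_cosMoment_zero hα, this]
  | succ k ih =>
    have hk : (0 : ℝ) ≤ k := k.cast_nonneg
    have h := cosMoment_add_two hα (2 * k)
    have hne : (0 : ℝ) < α + k + 1 := by linarith
    have hG : 0 < Real.Gamma (α + k + 1) := Real.Gamma_pos_of_pos hne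
    have e : α + ((k + 1 : ℕ) : ℝ) + 1 = (α + k + 1) + 1 := by push_cast; ring
    rw [e, Real.Gamma_add_one hne.ne', show 2 * (k + 1) = 2 * k + 1 + 1 by ring,
      Nat.factorial_succ, Nat.factorial_succ, Nat.factorial_succ, pow_succ]
    push_cast at h ⊢
    rw [eq_div_iff (by positivity)] at ih ⊢
    have hcancel : (α + k + 1) * 2 * (angleConst α * cosMoment α (2 * k + 2)) =
        (2 * k + 1) * (angleConst α * cosMoment α (2 * k)) := by linear_combination angleConst α * h
    linear_combination 2 * (4 ^ k * ((k : ℝ) + 1) * k.factorial * Real.Gamma (α + k + 1)) * hcancel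
      + 2 * ((k : ℝ) + 1) * (2 * k + 1) * ih

/-- The entire function `E_α(w) = j_α(iw)`, as a Poisson integral. -/
def poisson (α : ℝ) (w : ℂ) : ℂ := ∫ θ, Complex.exp (w * Real.cos θ) ∂(angleMeasure α)

lemma integral_cos_pow_angleMeasure {α : ℝ} (hα : -(1 / 2) < α) (m : ℕ) :
    ∫ θ, ((Real.cos θ : ℝ) : ℂ) ^ m ∂(angleMeasure α) =
      ((angleConst α * cosMoment α m : ℝ) : ℂ) := by
  rw [integral_angleMeasure hα, cosMoment, Complex.ofReal_mul, ← integral_complex_ofReal]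
  push_cast
  rfl

lemma norm_mul_cos_le (w : ℂ) (θ : ℝ) : ‖w * ((Real.cos θ : ℝ) : ℂ)‖ ≤ ‖w‖ := by
  rw [norm_mul, Complex.norm_real, Real.norm_eq_abs]
  exact mul_le_of_le_one_right (norm_nonneg _) (Real.abs_cos_le_one θ)

lemma hasSum_poisson_moments {α : ℝ} (hα : -(1 / 2) < α) (w : ℂ) :
    HasSum (fun m : ℕ => w ^ m / m.factorial * ((angleConst α * cosMoment α m : ℝ) : ℂ))
      (poisson α w) := by
  have := isProbabilityMeasure_angleMeasure hα
  have hb : ∀ (m : ℕ) θ, ‖(w * ((Real.cos θ : ℝ) : ℂ)) ^ m / (m.factorial : ℂ)‖ ≤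
      ‖w‖ ^ m / m.factorial := fun m θ => by
    rw [norm_div, norm_pow, Complex.norm_natCast]
    gcongr
    exact norm_mul_cos_le w θ
  have hint : ∀ m : ℕ, Integrable (fun θ => (w * ((Real.cos θ : ℝ) : ℂ)) ^ m / (m.factorial : ℂ))
      (angleMeasure α) := fun m =>
    Integrable.of_bound (by fun_prop : Measurable _).aestronglyMeasurable _
      (ae_of_all _ (hb m))
  have h := hasSum_integral_of_summable_integral_norm hint
    (Summable.of_nonneg_of_le (fun m => integral_nonneg fun _ => norm_nonneg _)
      (fun m => (integral_mono (hint m).norm (integrable_const _) (hb m)).trans (by simp))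
      (Real.summable_pow_div_factorial ‖w‖))
  convert! h using 1
  · funext m
    rw [← integral_cos_pow_angleMeasure hα, ← integral_const_mul]
    refine integral_congr_ae (ae_of_all _ fun θ => ?_)
    dsimp only
    rw [mul_pow]
    ring
  · rw [poisson]
    refine integral_congr_ae (ae_of_all _ fun θ => ?_)
    dsimp only
    rw [Complex.exp_eq_exp_ℂ, NormedSpace.exp_eq_tsum_div]

/-- The coefficients of the series of `E_α` in powers of `(w/2)²`. -/
def besselCoeff (α : ℝ) (k : ℕ) : ℝ :=
  Real.Gamma (α + 1) / (k.factorial * Real.Gamma (α + k + 1))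

/-- In the moment expansion of the exponential the odd cosine moments vanish, and the even ones are
exactly the Bessel coefficients. -/
lemma hasSum_poisson {α : ℝ} (hα : -(1 / 2) < α) (w : ℂ) :
    HasSum (fun k : ℕ => (besselCoeff α k : ℂ) * (w / 2) ^ (2 * k)) (poisson α w) := by
  have h := hasSum_poisson_moments hα w
  have hinj : Function.Injective fun k : ℕ => 2 * k := fun a b h => by simpa using h
  rw [← hinj.hasSum_iff] at h
  · convert h using 1
    funext k
    simp only [Function.comp_apply]
    rw [angleConst_mul_cosMoment_even hα, besselCoeff]
    have hk : (0 : ℝ) ≤ k := k.cast_nonneg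
    have hG : (Real.Gamma (α + k + 1) : ℂ) ≠ 0 :=
      Complex.ofReal_ne_zero.2 (Real.Gamma_pos_of_pos (by linarith)).ne'
    have h1 : ((2 * k).factorial : ℂ) ≠ 0 := Nat.cast_ne_zero.2 (Nat.factorial_ne_zero _)
    have h2 : (k.factorial : ℂ) ≠ 0 := Nat.cast_ne_zero.2 (Nat.factorial_ne_zero _)
    have h4 : (2 : ℂ) ^ (2 * k) = 4 ^ k := by rw [pow_mul]; norm_num
    push_cast
    rw [div_pow, h4]
    field_simp
  · intro m hm
    obtain ⟨k, rfl | rfl⟩ := Nat.even_or_odd' m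
    · exact absurd ⟨k, rfl⟩ hm
    · simp [cosMoment_odd hα]

/-- Poisson's representation of j_α. It supplies the bound |j_α| ≤ 1 and the measurability that the
series does not show directly. -/
lemma ofReal_besselJ {α : ℝ} (hα : -(1 / 2) < α) (t : ℝ) :
    ((besselJ α t : ℝ) : ℂ) = poisson α (Complex.I * t) := by
  rw [← (hasSum_poisson hα _).tsum_eq, besselJ, Complex.ofReal_mul, Complex.ofReal_tsum,
    ← tsum_mul_left]
  refine tsum_congr fun k => ?_
  rw [besselCoeff, mul_div_assoc Complex.I, mul_pow, pow_mul Complex.I, Complex.I_sq]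
  push_cast
  ring

lemma norm_poisson_le {α : ℝ} (hα : -(1 / 2) < α) (w : ℂ) :
    ‖poisson α w‖ ≤ Real.exp |w.re| := by
  have := isProbabilityMeasure_angleMeasure hα
  refine (norm_integral_le_of_norm_le_const (C := Real.exp |w.re|) (ae_of_all _ fun θ => ?_)).trans
    (by simp)
  rw [Complex.norm_exp]
  gcongr
  rw [Complex.re_mul_ofReal]
  refine (le_abs_self _).trans ?_
  rw [abs_mul]
  exact mul_le_of_le_one_right (abs_nonneg _) (Real.abs_cos_le_one θ)

lemma poisson_zero {α : ℝ} (hα : -(1 / 2) < α) : poisson α 0 = 1 := by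
  have := isProbabilityMeasure_angleMeasure hα
  simp [poisson]

lemma abs_besselJ_le {α : ℝ} (hα : -(1 / 2) < α) (t : ℝ) : |besselJ α t| ≤ 1 := by
  rw [← Real.norm_eq_abs, ← Complex.norm_real, ofReal_besselJ hα]
  simpa using norm_poisson_le hα (Complex.I * t)

lemma measurable_poisson {α : ℝ} (hα : -(1 / 2) < α) : Measurable (poisson α) := by
  have := isProbabilityMeasure_angleMeasure hα
  have h : StronglyMeasurable fun p : ℂ × ℝ => Complex.exp (p.1 * Real.cos p.2) :=
    (by fun_prop : Measurable _).stronglyMeasurable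
  exact h.integral_prod_right.measurable

lemma measurable_besselJ {α : ℝ} (hα : -(1 / 2) < α) : Measurable (besselJ α) := by
  have h : besselJ α = fun t : ℝ => (poisson α (Complex.I * t)).re := by
    funext t
    rw [← ofReal_besselJ hα, Complex.ofReal_re]
  rw [h]
  exact Complex.measurable_re.comp ((measurable_poisson hα).comp (by fun_prop))

lemma besselCoeff_pos {α : ℝ} (hα : -(1 / 2) < α) (k : ℕ) : 0 < besselCoeff α k := by
  have h1 : 0 < Real.Gamma (α + 1) := Real.Gamma_pos_of_pos (by linarith)
  have hk : (0 : ℝ) ≤ k := k.cast_nonneg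
  have hG : 0 < Real.Gamma (α + k + 1) := Real.Gamma_pos_of_pos (by linarith)
  unfold besselCoeff
  positivity

/-! ### The product form of the measure and radial Gaussian integrals. -/

/-- The normalizing constant of the measure `μ d α`. -/
def normConst (d : ℕ) (α : ℝ) : ℝ :=
  1 / ((2 * Real.pi) ^ d * (2 : ℝ) ^ (2 * α) * Real.Gamma (α + 1) ^ 2)

lemma normConst_pos (d : ℕ) {α : ℝ} (hα : -(1 / 2) < α) : 0 < normConst d α := by
  have h1 : 0 < Real.Gamma (α + 1) := Real.Gamma_pos_of_pos (by linarith)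
  have := Real.pi_pos
  unfold normConst
  positivity

/-- The measure on the last coordinate: `μ d α` is the product of it with Lebesgue measure. -/
def radialMeasure (d : ℕ) (α : ℝ) : Measure ℝ :=
  (volume.restrict (Ioi 0)).withDensity fun y => ENNReal.ofReal (normConst d α * y ^ (2 * α + 1))

instance (d : ℕ) (α : ℝ) : SFinite (radialMeasure d α) := by
  unfold radialMeasure; infer_instance

lemma μ_eq_prod (d : ℕ) (α : ℝ) :
    μ d α = (volume : Measure (EuclideanSpace ℝ (Fin d))).prod (radialMeasure d α) := by
  rw [radialMeasure, prod_withDensity_right (by fun_prop), μ]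
  have h : (volume : Measure (EuclideanSpace ℝ (Fin d))).prod (volume.restrict (Ioi (0 : ℝ))) =
      (volume : Measure (Space d)).restrict (halfSpace d) := by
    nth_rw 1 [← Measure.restrict_univ (μ := (volume : Measure (EuclideanSpace ℝ (Fin d))))]
    rw [Measure.prod_restrict]
    congr 1
    ext x
    simp [halfSpace]
  rw [h]
  congr 1
  funext x
  rw [normConst, div_mul_eq_mul_div, one_mul]

instance (d : ℕ) (α : ℝ) : SFinite (μ d α) := by
  rw [μ_eq_prod]; infer_instance

instance (d : ℕ) (α : ℝ) : SigmaFinite (radialMeasure d α) := by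
  unfold radialMeasure; infer_instance

instance (d : ℕ) (α : ℝ) : SigmaFinite (μ d α) := by
  rw [μ_eq_prod]; infer_instance

lemma ae_radialMeasure_pos (d : ℕ) (α : ℝ) : ∀ᵐ y ∂(radialMeasure d α), 0 < y :=
  (withDensity_absolutelyContinuous _ _).ae_le (ae_restrict_mem measurableSet_Ioi)

lemma measurableSet_halfSpace (d : ℕ) : MeasurableSet (halfSpace d) :=
  measurableSet_lt measurable_const measurable_snd

lemma ae_mem_halfSpace (d : ℕ) (α : ℝ) : ∀ᵐ x ∂(μ d α), 0 < x.2 :=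
  (withDensity_absolutelyContinuous _ _).ae_le (ae_restrict_mem (measurableSet_halfSpace d))

lemma integral_radialMeasure (d : ℕ) {α : ℝ} (hα : -(1 / 2) < α)
    {F : Type*} [NormedAddCommGroup F] [NormedSpace ℝ F] (f : ℝ → F) :
    ∫ y, f y ∂(radialMeasure d α) =
      normConst d α • ∫ y in Ioi (0 : ℝ), y ^ (2 * α + 1) • f y := by
  rw [radialMeasure, integral_withDensity_eq_integral_toReal_smul (by fun_prop) (by simp),
    ← integral_smul]
  refine setIntegral_congr_fun measurableSet_Ioi fun y hy => ?_
  have hy : 0 < y := hy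
  have := normConst_pos d hα
  rw [ENNReal.toReal_ofReal (by positivity), smul_smul]

lemma integrable_radialMeasure_iff (d : ℕ) {α : ℝ} (hα : -(1 / 2) < α)
    {F : Type*} [NormedAddCommGroup F] [NormedSpace ℝ F] (f : ℝ → F) :
    Integrable f (radialMeasure d α) ↔
      IntegrableOn (fun y => y ^ (2 * α + 1) • f y) (Ioi 0) := by
  have hK := normConst_pos d hα
  rw [radialMeasure, integrable_withDensity_iff_integrable_smul' (by fun_prop) (by simp)]
  have h : (fun y : ℝ => (ENNReal.ofReal (normConst d α * y ^ (2 * α + 1))).toReal • f y)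
      =ᵐ[volume.restrict (Ioi 0)] fun y => normConst d α • (y ^ (2 * α + 1) • f y) := by
    refine (ae_restrict_mem measurableSet_Ioi).mono fun y hy => ?_
    have hy : 0 < y := hy
    dsimp only
    rw [ENNReal.toReal_ofReal (by positivity), smul_smul]
  rw [integrable_congr h, integrable_fun_smul_iff hK.ne']
  rfl

/-- The Gaussian integral `∫ exp(-s y²) dν(y)` of the radial measure. -/
def gaussConst (d : ℕ) (α s : ℝ) : ℝ :=
  normConst d α * Real.Gamma (α + 1) / (2 * s ^ (α + 1))

lemma integrable_pow_mul_exp_radial (d : ℕ) {α : ℝ} (hα : -(1 / 2) < α) {s : ℝ} (hs : 0 < s)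
    (k : ℕ) : Integrable (fun y : ℝ => y ^ k * Real.exp (-s * y ^ 2)) (radialMeasure d α) := by
  rw [integrable_radialMeasure_iff d hα]
  have hk : (0 : ℝ) ≤ k := k.cast_nonneg
  refine (integrableOn_rpow_mul_exp_neg_mul_sq hs (s := 2 * α + 1 + k) (by linarith)).congr_fun
    (fun y hy => ?_) measurableSet_Ioi
  have hy : 0 < y := hy
  dsimp only
  rw [Real.rpow_add hy, Real.rpow_natCast, smul_eq_mul, mul_assoc]

/-- The moment is written through `besselCoeff` so that it cancels the coefficient of the Poisson
series and leaves an exponential series in `integral_gauss_mul_poisson`. -/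
lemma integral_pow_mul_exp_radial (d : ℕ) {α : ℝ} (hα : -(1 / 2) < α) {s : ℝ} (hs : 0 < s)
    (k : ℕ) : ∫ y, y ^ (2 * k) * Real.exp (-s * y ^ 2) ∂(radialMeasure d α) =
      gaussConst d α s * (1 / (besselCoeff α k * k.factorial * s ^ k)) := by
  have hk : (0 : ℝ) ≤ k := k.cast_nonneg
  have h := integral_rpow_mul_exp_neg_mul_rpow two_pos (q := 2 * α + 1 + (2 * k : ℕ))
    (by push_cast; linarith) hs
  rw [integral_radialMeasure d hα]
  have h2 : ∫ y in Ioi (0 : ℝ), y ^ (2 * α + 1) • (y ^ (2 * k) * Real.exp (-s * y ^ 2)) =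
      ∫ y in Ioi (0 : ℝ), y ^ (2 * α + 1 + (2 * k : ℕ)) * Real.exp (-s * y ^ (2 : ℝ)) := by
    refine setIntegral_congr_fun measurableSet_Ioi fun y hy => ?_
    have hy : 0 < y := hy
    rw [Real.rpow_add hy _ ((2 * k : ℕ) : ℝ), Real.rpow_natCast, smul_eq_mul, mul_assoc,
      Real.rpow_two]
  have e1 : (2 * α + 1 + ((2 * k : ℕ) : ℝ) + 1) / 2 = α + k + 1 := by push_cast; ring
  have e2 : -(2 * α + 1 + ((2 * k : ℕ) : ℝ) + 1) / 2 = -(α + 1 + k) := by push_cast; ring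
  have hG : 0 < Real.Gamma (α + k + 1) := Real.Gamma_pos_of_pos (by linarith)
  have hG1 : 0 < Real.Gamma (α + 1) := Real.Gamma_pos_of_pos (by linarith)
  have hS : 0 < s ^ (α + 1) := by positivity
  rw [h2, h, e1, e2, Real.rpow_neg hs.le, Real.rpow_add hs, Real.rpow_natCast, gaussConst,
    besselCoeff, smul_eq_mul]
  generalize Real.Gamma (α + 1) = A at *
  generalize Real.Gamma (α + k + 1) = B at *
  generalize s ^ (α + 1) = S at *
  field_simp

lemma integrable_exp_mul_exp_radial (d : ℕ) {α : ℝ} (hα : -(1 / 2) < α) {s : ℝ} (hs : 0 < s)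
    (c : ℝ) : Integrable (fun y : ℝ => Real.exp (-s * y ^ 2 + c * y)) (radialMeasure d α) := by
  -- Completing the square gives -s y² + c y ≤ c²/(2s) - (s/2) y²: half of the Gaussian decay
  -- absorbs the linear term.
  have h := (integrable_pow_mul_exp_radial d hα (half_pos hs) 0).const_mul
    (Real.exp (c ^ 2 / (2 * s)))
  refine h.mono (by fun_prop : Measurable _).aestronglyMeasurable (ae_of_all _ fun y => ?_)
  rw [pow_zero, one_mul, ← Real.exp_add, Real.norm_eq_abs, Real.norm_eq_abs, Real.abs_exp,
    Real.abs_exp, Real.exp_le_exp]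
  have h2 : c ^ 2 / (2 * s) + -(s / 2) * y ^ 2 - (-s * y ^ 2 + c * y) =
      (s * y - c) ^ 2 / (2 * s) := by
    field_simp
    ring
  have h3 : 0 ≤ (s * y - c) ^ 2 / (2 * s) := by positivity
  linarith

lemma norm_gauss_mul_poisson_le {α : ℝ} (hα : -(1 / 2) < α) (s : ℝ) (w : ℂ) {y : ℝ} (hy : 0 < y) :
    ‖Complex.exp (-s * y ^ 2) * poisson α (w * y)‖ ≤ Real.exp (-s * y ^ 2 + |w.re| * y) := by
  rw [norm_mul, Real.exp_add, Complex.norm_exp]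
  have h : (-(s : ℂ) * (y : ℂ) ^ 2).re = -s * y ^ 2 := by
    rw [show -(s : ℂ) * (y : ℂ) ^ 2 = ((-s * y ^ 2 : ℝ) : ℂ) by push_cast; ring,
      Complex.ofReal_re]
  rw [h]
  gcongr
  refine (norm_poisson_le hα _).trans_eq ?_
  rw [Complex.re_mul_ofReal, abs_mul, abs_of_pos hy]

lemma integrable_gauss_mul_poisson (d : ℕ) {α : ℝ} (hα : -(1 / 2) < α) {s : ℝ} (hs : 0 < s)
    (w : ℂ) : Integrable (fun y : ℝ => Complex.exp (-s * y ^ 2) * poisson α (w * y))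
      (radialMeasure d α) := by
  refine (integrable_exp_mul_exp_radial d hα hs |w.re|).mono' ?_ ?_
  · exact ((by fun_prop : Measurable fun y : ℝ => Complex.exp (-s * y ^ 2)).mul
      ((measurable_poisson hα).comp (by fun_prop))).aestronglyMeasurable
  · exact (ae_radialMeasure_pos d α).mono fun y hy => norm_gauss_mul_poisson_le hα s w hy

/-- The Hankel transform of a Gaussian, for complex frequencies. -/
lemma integral_gauss_mul_poisson (d : ℕ) {α : ℝ} (hα : -(1 / 2) < α) {s : ℝ} (hs : 0 < s)
    (w : ℂ) : ∫ y : ℝ, Complex.exp (-s * y ^ 2) * poisson α (w * y) ∂(radialMeasure d α) =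
      gaussConst d α s * Complex.exp (w ^ 2 / (4 * s)) := by
  set F : ℕ → ℝ → ℂ := fun k y =>
    ((besselCoeff α k : ℝ) : ℂ) * (w / 2) ^ (2 * k) *
      ((y ^ (2 * k) * Real.exp (-s * y ^ 2) : ℝ) : ℂ) with hF
  have hcoef : ∀ k, besselCoeff α k ≠ 0 := fun k => (besselCoeff_pos hα k).ne'
  have hint : ∀ k, Integrable (F k) (radialMeasure d α) := fun k =>
    (integrable_pow_mul_exp_radial d hα hs (2 * k)).ofReal.const_mul _
  have hnorm : ∀ k, ∫ y, ‖F k y‖ ∂(radialMeasure d α) =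
      gaussConst d α s * ((‖w‖ ^ 2 / (4 * s)) ^ k / k.factorial) := fun k => by
    have : ∀ y : ℝ, ‖F k y‖ = besselCoeff α k * (‖w‖ / 2) ^ (2 * k) *
        (y ^ (2 * k) * Real.exp (-s * y ^ 2)) := fun y => by
      have h0 : 0 ≤ y ^ (2 * k) * Real.exp (-s * y ^ 2) :=
        mul_nonneg (by rw [pow_mul]; positivity) (Real.exp_pos _).le
      simp only [hF]
      rw [norm_mul, norm_mul, Complex.norm_real, Complex.norm_real, norm_pow, norm_div,
        Real.norm_of_nonneg h0, Real.norm_of_nonneg (besselCoeff_pos hα k).le]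
      simp
    simp_rw [this]
    rw [integral_const_mul, integral_pow_mul_exp_radial d hα hs, pow_mul]
    have := hcoef k
    rw [div_pow ‖w‖, div_pow (‖w‖ ^ 2) (4 * s), mul_pow 4 s]
    field_simp
    norm_num
    rw [div_pow]
    field_simp
  have hval : ∀ k, ∫ y, F k y ∂(radialMeasure d α) =
      gaussConst d α s * ((w ^ 2 / (4 * s)) ^ k / k.factorial) := fun k => by
    have h1 : ((besselCoeff α k : ℝ) : ℂ) ≠ 0 := Complex.ofReal_ne_zero.2 (hcoef k)
    have h2 : (s : ℂ) ≠ 0 := Complex.ofReal_ne_zero.2 hs.ne'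
    have h3 : (k.factorial : ℂ) ≠ 0 := Nat.cast_ne_zero.2 (Nat.factorial_ne_zero _)
    simp only [hF]
    rw [integral_const_mul, integral_complex_ofReal, integral_pow_mul_exp_radial d hα hs, pow_mul]
    rw [div_pow w, div_pow (w ^ 2) (4 * s : ℂ), mul_pow 4 (s : ℂ)]
    push_cast
    field_simp
    norm_num
    rw [div_pow]
    field_simp
  -- The integrals of the norms form the exponential series at ‖w‖²/(4s), which justifies
  -- integrating term by term for every complex w.
  have hsum := hasSum_integral_of_summable_integral_norm hint (by
    simp_rw [hnorm]
    exact (Real.summable_pow_div_factorial _).mul_left _)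
  have hE : ∀ y : ℝ, ∑' k, F k y = Complex.exp (-s * y ^ 2) * poisson α (w * y) := fun y => by
    rw [← ((hasSum_poisson hα (w * y)).mul_left (Complex.exp (-s * y ^ 2))).tsum_eq]
    refine tsum_congr fun k => ?_
    simp only [hF]
    rw [mul_div_right_comm, mul_pow]
    push_cast
    ring
  simp_rw [hE, hval] at hsum
  refine hsum.unique ?_
  have hx := NormedSpace.expSeries_div_hasSum_exp (w ^ 2 / (4 * s))
  rw [← Complex.exp_eq_exp_ℂ] at hx
  exact hx.mul_left _

/-! ### Gaussian integrals in the Euclidean variable. -/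

lemma ofReal_norm_sq_eq {V : Type*} [NormedAddCommGroup V] [InnerProductSpace ℝ V] (x : V) :
    (‖x‖ : ℂ) ^ 2 = ((inner ℝ x x : ℝ) : ℂ) := by
  rw [real_inner_self_eq_norm_sq]; push_cast; rfl

section Euclidean

variable {V : Type*} [NormedAddCommGroup V] [InnerProductSpace ℝ V] [FiniteDimensional ℝ V]
  [MeasurableSpace V] [BorelSpace V]

/-- A modulated Gaussian on a Euclidean space. -/
def modGauss (b x : V) : ℂ :=
  Complex.exp (-(1 / 2 : ℂ) * (‖x‖ : ℂ) ^ 2 + Complex.I * ((inner ℝ b x : ℝ) : ℂ))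

/-- A translated Gaussian on a Euclidean space. -/
def shiftGauss (b x : V) : ℂ := Complex.exp (-(1 / 2 : ℂ) * (‖x - b‖ : ℂ) ^ 2)

/-- The inverse Fourier transform of the product of two translated Gaussians. -/
def gaussCorrelation (b c x : V) : ℂ :=
  (Real.pi / 1 : ℂ) ^ (Module.finrank ℝ V / 2 : ℂ) *
    Complex.exp (-(1 / 4 : ℂ) * (‖x‖ : ℂ) ^ 2 - (1 / 4 : ℂ) * (‖b - c‖ : ℂ) ^ 2 -
      Complex.I / 2 * ((inner ℝ x (b + c) : ℝ) : ℂ))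

lemma integral_modGauss_mul_exp (b x : V) :
    ∫ y, modGauss b y * Complex.exp (-Complex.I * ((inner ℝ y x : ℝ) : ℂ)) =
      (2 * Real.pi : ℂ) ^ (Module.finrank ℝ V / 2 : ℂ) * shiftGauss b x := by
  have h := GaussianFourier.integral_cexp_neg_mul_sq_norm_add (b := 1 / 2) (by norm_num)
    Complex.I (b - x)
  have e : (Real.pi / (1 / 2) : ℂ) = 2 * Real.pi := by ring
  rw [e] at h
  convert! h using 1
  · refine integral_congr_ae (ae_of_all _ fun y => ?_)
    dsimp only
    rw [modGauss, ← Complex.exp_add, inner_sub_left, real_inner_comm x y]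
    congr 1
    push_cast
    ring
  · rw [shiftGauss, ← norm_neg (x - b), neg_sub, Complex.I_sq]
    congr 2
    ring

lemma integral_modGauss_mul_conj (b c x : V) :
    ∫ y, modGauss b y * conj (modGauss c (x + y)) = gaussCorrelation b c x := by
  -- Moving the origin to the midpoint turns the quadratic part into -‖y‖² - ‖x‖²/4, without a cross
  -- term.
  rw [← integral_sub_right_eq_self _ ((1 / 2 : ℝ) • x)]
  have h := GaussianFourier.integral_cexp_neg_mul_sq_norm_add (b := 1) (by norm_num)
    Complex.I (b - c)
  have h2 := congrArg (fun z => z * Complex.exp (-(1 / 4 : ℂ) * (‖x‖ : ℂ) ^ 2 -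
    Complex.I / 2 * ((inner ℝ x (b + c) : ℝ) : ℂ))) h
  simp only [← integral_mul_const] at h2
  convert! h2 using 1
  · refine integral_congr_ae (ae_of_all _ fun y => ?_)
    dsimp only
    rw [modGauss, modGauss, ← Complex.exp_conj, ← Complex.exp_add, ← Complex.exp_add]
    simp only [map_add, map_mul, map_neg, Complex.conj_ofReal, Complex.conj_I, map_div₀,
      map_one, map_ofNat, ofReal_norm_sq_eq, inner_sub_left, inner_sub_right, inner_add_left,
      inner_add_right, inner_smul_left, inner_smul_right, real_inner_comm x y, real_inner_comm x b,
      real_inner_comm x c, real_inner_comm y b, real_inner_comm y c]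
    congr 1
    push_cast
    ring
  · rw [gaussCorrelation, mul_assoc, ← Complex.exp_add, Complex.I_sq]
    congr 2
    ring

lemma integral_shiftGauss_mul_shiftGauss (b c x : V) :
    ∫ y, shiftGauss b y * conj (shiftGauss c y) *
      Complex.exp (-Complex.I * ((inner ℝ x y : ℝ) : ℂ)) = gaussCorrelation b c x := by
  -- Recentring at the midpoint of b and c removes the cross term in the same way.
  rw [← integral_add_right_eq_self _ ((1 / 2 : ℝ) • (b + c))]
  have h := GaussianFourier.integral_cexp_neg_mul_sq_norm_add (b := 1) (by norm_num)
    (-Complex.I) x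
  have h2 := congrArg (fun z => z * Complex.exp (-(1 / 4 : ℂ) * (‖b - c‖ : ℂ) ^ 2 -
    Complex.I / 2 * ((inner ℝ x (b + c) : ℝ) : ℂ))) h
  simp only [← integral_mul_const] at h2
  convert! h2 using 1
  · refine integral_congr_ae (ae_of_all _ fun y => ?_)
    dsimp only
    rw [shiftGauss, shiftGauss, ← Complex.exp_conj, ← Complex.exp_add, ← Complex.exp_add,
      ← Complex.exp_add]
    simp only [map_mul, map_neg, Complex.conj_ofReal, map_div₀,
      map_one, map_ofNat, ofReal_norm_sq_eq, inner_sub_left, inner_sub_right, inner_add_left,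
      inner_add_right, inner_smul_left, inner_smul_right, real_inner_comm y b,
      real_inner_comm y c, real_inner_comm b c]
    congr 1
    push_cast
    ring
  · rw [gaussCorrelation, mul_assoc, ← Complex.exp_add, neg_sq, Complex.I_sq]
    congr 2
    ring

end Euclidean

/-! ### Gaussians on the half-space: transforms, translates and correlations. -/

/-- The point of the half-space over which the generalized translation averages. -/
def shift {d : ℕ} (x : Space d) (p : Space d × ℝ) : Space d :=
  (x.1 + p.1.1, √(x.2 ^ 2 + p.1.2 ^ 2 + 2 * x.2 * p.1.2 * Real.cos p.2))

lemma translation_eq {d : ℕ} {α : ℝ} (hα : -(1 / 2) < α) (x : Space d) (u : Space d → ℂ)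
    (y : Space d) : translation α x u y = ∫ θ, u (shift x (y, θ)) ∂(angleMeasure α) := by
  rw [integral_angleMeasure hα]
  rfl

lemma continuous_shift {d : ℕ} : Continuous fun q : Space d × (Space d × ℝ) => shift q.1 q.2 := by
  unfold shift
  fun_prop

lemma sq_shift_snd {d : ℕ} (x : Space d) (p : Space d × ℝ) :
    (shift x p).2 ^ 2 = x.2 ^ 2 + p.1.2 ^ 2 + 2 * x.2 * p.1.2 * Real.cos p.2 := by
  refine Real.sq_sqrt ?_
  nlinarith [sq_nonneg (x.2 + p.1.2 * Real.cos p.2), Real.sin_sq_add_cos_sq p.2,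
    sq_nonneg (p.1.2 * Real.sin p.2)]

/-- A Gaussian on `ℝ^{d+1}`, modulated in the first `d` variables. -/
def gauss {d : ℕ} (b : EuclideanSpace ℝ (Fin d)) (s : ℝ) (x : Space d) : ℂ :=
  modGauss b x.1 * Complex.exp (-s * x.2 ^ 2)

/-- The Weinstein transform of `gauss b s`, up to a constant. -/
def gaussHat {d : ℕ} (b : EuclideanSpace ℝ (Fin d)) (s : ℝ) (x : Space d) : ℂ :=
  shiftGauss b x.1 * Complex.exp (-((1 / (4 * s) : ℝ) : ℂ) * x.2 ^ 2)

lemma norm_cexp_neg_mul_sq (s y : ℝ) :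
    ‖Complex.exp (-(s : ℂ) * (y : ℂ) ^ 2)‖ = Real.exp (-s * y ^ 2) := by
  rw [show -(s : ℂ) * (y : ℂ) ^ 2 = ((-s * y ^ 2 : ℝ) : ℂ) by push_cast; ring,
    ← Complex.ofReal_exp, Complex.norm_real, Real.norm_of_nonneg (Real.exp_pos _).le]

lemma norm_modGauss {V : Type*} [NormedAddCommGroup V] [InnerProductSpace ℝ V] (b x : V) :
    ‖modGauss b x‖ = Real.exp (-(1 / 2) * ‖x‖ ^ 2) := by
  rw [modGauss, Complex.exp_add, norm_mul, mul_comm Complex.I, Complex.norm_exp_ofReal_mul_I,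
    mul_one, ← norm_cexp_neg_mul_sq]
  norm_num

lemma norm_shiftGauss {V : Type*} [NormedAddCommGroup V] [InnerProductSpace ℝ V] (b x : V) :
    ‖shiftGauss b x‖ = Real.exp (-(1 / 2) * ‖x - b‖ ^ 2) := by
  rw [shiftGauss, ← norm_cexp_neg_mul_sq]
  norm_num

lemma continuous_modGauss {V : Type*} [NormedAddCommGroup V] [InnerProductSpace ℝ V] (b : V) :
    Continuous (modGauss b) := by
  unfold modGauss; fun_prop

lemma continuous_gauss {d : ℕ} (b : EuclideanSpace ℝ (Fin d)) (s : ℝ) :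
    Continuous (gauss b s) := by
  unfold gauss
  exact ((continuous_modGauss b).comp continuous_fst).mul (by fun_prop)

lemma norm_gauss {d : ℕ} (b : EuclideanSpace ℝ (Fin d)) (s : ℝ) (x : Space d) :
    ‖gauss b s x‖ = Real.exp (-(1 / 2) * ‖x.1‖ ^ 2) * Real.exp (-s * x.2 ^ 2) := by
  rw [gauss, norm_mul, norm_modGauss, norm_cexp_neg_mul_sq]

lemma norm_gauss_le_one {d : ℕ} (b : EuclideanSpace ℝ (Fin d)) {s : ℝ} (hs : 0 < s)
    (x : Space d) : ‖gauss b s x‖ ≤ 1 := by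
  rw [norm_gauss, ← Real.exp_add, Real.exp_le_one_iff]
  have : 0 ≤ s * x.2 ^ 2 := by positivity
  nlinarith [sq_nonneg ‖x.1‖]

lemma norm_gaussHat_le_one {d : ℕ} (b : EuclideanSpace ℝ (Fin d)) {s : ℝ} (hs : 0 < s)
    (x : Space d) : ‖gaussHat b s x‖ ≤ 1 := by
  rw [gaussHat, norm_mul, norm_shiftGauss, norm_cexp_neg_mul_sq, ← Real.exp_add,
    Real.exp_le_one_iff]
  have : 0 ≤ 1 / (4 * s) * x.2 ^ 2 := by positivity
  nlinarith [sq_nonneg ‖x.1 - b‖]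

lemma integrable_modGauss {V : Type*} [NormedAddCommGroup V] [InnerProductSpace ℝ V]
    [FiniteDimensional ℝ V] [MeasurableSpace V] [BorelSpace V] (b : V) :
    Integrable (modGauss b) := by
  exact GaussianFourier.integrable_cexp_neg_mul_sq_norm_add (b := 1 / 2) (by norm_num) _ b

lemma integrable_shiftGauss {V : Type*} [NormedAddCommGroup V] [InnerProductSpace ℝ V]
    [FiniteDimensional ℝ V] [MeasurableSpace V] [BorelSpace V] (b : V) :
    Integrable (shiftGauss b) := by
  have h := (integrable_modGauss (0 : V)).comp_sub_right b
  refine h.congr (ae_of_all _ fun x => ?_)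
  simp [modGauss, shiftGauss]

lemma integrable_cexp_neg_mul_sq_radial (d : ℕ) {α : ℝ} (hα : -(1 / 2) < α) {s : ℝ} (hs : 0 < s) :
    Integrable (fun y : ℝ => Complex.exp (-s * y ^ 2)) (radialMeasure d α) := by
  simpa [poisson_zero hα] using integrable_gauss_mul_poisson d hα hs 0

lemma integrable_gauss {d : ℕ} {α : ℝ} (hα : -(1 / 2) < α) (b : EuclideanSpace ℝ (Fin d))
    {s : ℝ} (hs : 0 < s) : Integrable (gauss b s) (μ d α) := by
  rw [μ_eq_prod]
  exact (integrable_modGauss b).mul_prod (integrable_cexp_neg_mul_sq_radial d hα hs)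

lemma integrable_gaussHat {d : ℕ} {α : ℝ} (hα : -(1 / 2) < α) (b : EuclideanSpace ℝ (Fin d))
    {s : ℝ} (hs : 0 < s) : Integrable (gaussHat b s) (μ d α) := by
  rw [μ_eq_prod]
  exact (integrable_shiftGauss b).mul_prod
    (integrable_cexp_neg_mul_sq_radial d hα (s := 1 / (4 * s)) (by positivity))

lemma memLp_two_of_integrable_of_norm_le_one {X : Type*} [MeasurableSpace X] {m : Measure X}
    {f : X → ℂ} (hf : Integrable f m) (h : ∀ x, ‖f x‖ ≤ 1) : MemLp f 2 m := by
  rw [memLp_two_iff_integrable_sq_norm hf.1]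
  refine hf.norm.mono (hf.1.norm.pow 2) (ae_of_all _ fun x => ?_)
  rw [norm_pow, norm_norm]
  nlinarith [h x, norm_nonneg (f x)]

lemma memLp_gauss {d : ℕ} {α : ℝ} (hα : -(1 / 2) < α) (b : EuclideanSpace ℝ (Fin d))
    {s : ℝ} (hs : 0 < s) : MemLp (gauss b s) 2 (μ d α) :=
  memLp_two_of_integrable_of_norm_le_one (integrable_gauss hα b hs) (norm_gauss_le_one b hs)

lemma memLp_gaussHat {d : ℕ} {α : ℝ} (hα : -(1 / 2) < α) (b : EuclideanSpace ℝ (Fin d))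
    {s : ℝ} (hs : 0 < s) : MemLp (gaussHat b s) 2 (μ d α) :=
  memLp_two_of_integrable_of_norm_le_one (integrable_gaussHat hα b hs) (norm_gaussHat_le_one b hs)

lemma kernel_eq {d : ℕ} {α : ℝ} (hα : -(1 / 2) < α) (x ξ : Space d) :
    kernel α x ξ = Complex.exp (-Complex.I * ((inner ℝ x.1 ξ.1 : ℝ) : ℂ)) *
      poisson α (Complex.I * x.2 * ξ.2) := by
  rw [kernel, ofReal_besselJ hα]
  push_cast
  rw [mul_assoc Complex.I]

lemma norm_kernel_le {d : ℕ} {α : ℝ} (hα : -(1 / 2) < α) (x ξ : Space d) :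
    ‖kernel α x ξ‖ ≤ 1 := by
  rw [kernel, norm_mul, Complex.norm_real, Real.norm_eq_abs, neg_mul, mul_comm Complex.I,
    ← neg_mul, ← Complex.ofReal_neg, Complex.norm_exp_ofReal_mul_I, one_mul]
  exact abs_besselJ_le hα _

lemma measurable_kernel {d : ℕ} {α : ℝ} (hα : -(1 / 2) < α) :
    Measurable fun p : Space d × Space d => kernel α p.1 p.2 := by
  unfold kernel
  refine (by fun_prop : Measurable fun p : Space d × Space d =>
    Complex.exp (-Complex.I * ((inner ℝ p.1.1 p.2.1 : ℝ) : ℂ))).mul ?_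
  exact Complex.measurable_ofReal.comp ((measurable_besselJ hα).comp (by fun_prop))

lemma kernel_comm {d : ℕ} (α : ℝ) (x ξ : Space d) : kernel α x ξ = kernel α ξ x := by
  rw [kernel, kernel, real_inner_comm, mul_comm x.2]

/-- The Fourier normalization `(2π)^{d/2}`. -/
def spatialConst (d : ℕ) : ℝ := (2 * Real.pi) ^ ((d : ℝ) / 2)

lemma ofReal_spatialConst (d : ℕ) :
    ((spatialConst d : ℝ) : ℂ) =
      (2 * Real.pi : ℂ) ^ (Module.finrank ℝ (EuclideanSpace ℝ (Fin d)) / 2 : ℂ) := by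
  rw [spatialConst, Complex.ofReal_cpow (by positivity)]
  simp

lemma fourierIntegral_gauss {d : ℕ} {α : ℝ} (hα : -(1 / 2) < α) (b : EuclideanSpace ℝ (Fin d))
    {s : ℝ} (hs : 0 < s) (ξ : Space d) :
    fourierIntegral α (gauss b s) ξ =
      ((spatialConst d * gaussConst d α s : ℝ) : ℂ) * gaussHat b s ξ := by
  have h1 := integral_modGauss_mul_exp b ξ.1
  have h2 := integral_gauss_mul_poisson d hα hs (Complex.I * ξ.2)
  rw [fourierIntegral, μ_eq_prod]
  have e : ∀ x : Space d, gauss b s x * kernel α x ξ =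
      (modGauss b x.1 * Complex.exp (-Complex.I * ((inner ℝ x.1 ξ.1 : ℝ) : ℂ))) *
        (Complex.exp (-s * x.2 ^ 2) * poisson α (Complex.I * ξ.2 * x.2)) := fun x => by
    rw [kernel_eq hα, gauss, mul_right_comm Complex.I]
    ring
  simp_rw [e]
  rw [integral_prod_mul (fun y => modGauss b y *
      Complex.exp (-Complex.I * ((inner ℝ y ξ.1 : ℝ) : ℂ)))
    (fun y : ℝ => Complex.exp (-s * y ^ 2) * poisson α (Complex.I * ξ.2 * y)), h1, h2, gaussHat,
    ← ofReal_spatialConst]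
  have e2 : (Complex.I * ξ.2) ^ 2 / (4 * s) = -((1 / (4 * s) : ℝ) : ℂ) * (ξ.2 : ℂ) ^ 2 := by
    rw [mul_pow, Complex.I_sq]
    push_cast
    ring
  rw [e2]
  push_cast
  ring

/-- By `sq_shift_snd`, θ enters only through exp(-2t x_{d+1} y_{d+1} cos θ), and its angular average
is a Poisson integral at a real argument. -/
lemma integral_gauss_shift {d : ℕ} (α : ℝ) (c : EuclideanSpace ℝ (Fin d)) (t : ℝ)
    (x y : Space d) :
    ∫ θ, gauss c t (shift x (y, θ)) ∂(angleMeasure α) =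
      modGauss c (x.1 + y.1) * (Complex.exp (-t * x.2 ^ 2) *
        (Complex.exp (-t * y.2 ^ 2) * poisson α (((-(2 * t * x.2) : ℝ) : ℂ) * y.2))) := by
  rw [poisson, ← integral_const_mul, ← integral_const_mul, ← integral_const_mul]
  refine integral_congr_ae (ae_of_all _ fun θ => ?_)
  have h := congrArg (fun r : ℝ => (r : ℂ)) (sq_shift_snd x (y, θ))
  dsimp only at h
  rw [Complex.ofReal_pow] at h
  dsimp only
  rw [gauss, h, ← Complex.exp_add, ← Complex.exp_add]
  have h1 : (shift x (y, θ)).1 = x.1 + y.1 := rfl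
  rw [h1]
  congr 2
  push_cast
  ring

lemma conj_poisson_ofReal (α r : ℝ) : conj (poisson α r) = poisson α r := by
  rw [poisson, ← integral_conj]
  refine integral_congr_ae (ae_of_all _ fun θ => ?_)
  dsimp only
  rw [← Complex.exp_conj, map_mul, Complex.conj_ofReal, Complex.conj_ofReal]

lemma conj_cexp_neg_mul_sq (s y : ℝ) :
    conj (Complex.exp (-(s : ℂ) * (y : ℂ) ^ 2)) = Complex.exp (-(s : ℂ) * (y : ℂ) ^ 2) := by
  rw [← Complex.exp_conj]
  simp

/-- The variables separate. The radial factor is the Hankel formula at the real frequency -2t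
x_{d+1}, and -t + t²/(s+t) = -st/(s+t) gives the exponent. -/
lemma integral_gauss_mul_conj_translate {d : ℕ} {α : ℝ} (hα : -(1 / 2) < α)
    (b c : EuclideanSpace ℝ (Fin d)) {s t : ℝ} (hs : 0 < s) (ht : 0 < t) (x : Space d) :
    ∫ y, gauss b s y * conj (∫ θ, gauss c t (shift x (y, θ)) ∂(angleMeasure α)) ∂(μ d α) =
      gaussConst d α (s + t) * (gaussCorrelation b c x.1 *
        Complex.exp (-((s * t / (s + t) : ℝ) : ℂ) * (x.2 : ℂ) ^ 2)) := by
  have h1 := integral_modGauss_mul_conj b c x.1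
  have h2 := integral_gauss_mul_poisson d hα (add_pos hs ht) ((-(2 * t * x.2) : ℝ) : ℂ)
  rw [μ_eq_prod]
  have e : ∀ y : Space d,
      gauss b s y * conj (∫ θ, gauss c t (shift x (y, θ)) ∂(angleMeasure α)) =
      (modGauss b y.1 * conj (modGauss c (x.1 + y.1))) * (Complex.exp (-t * x.2 ^ 2) *
        (Complex.exp (-((s + t : ℝ) : ℂ) * y.2 ^ 2) *
          poisson α (((-(2 * t * x.2) : ℝ) : ℂ) * y.2))) := fun y => by
    have e1 : Complex.exp (-((s + t : ℝ) : ℂ) * y.2 ^ 2) =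
        Complex.exp (-s * y.2 ^ 2) * Complex.exp (-t * y.2 ^ 2) := by
      rw [← Complex.exp_add]; congr 1; push_cast; ring
    rw [integral_gauss_shift, gauss, e1, map_mul, map_mul, map_mul, conj_cexp_neg_mul_sq,
      conj_cexp_neg_mul_sq, ← Complex.ofReal_mul, conj_poisson_ofReal]
    ring
  simp_rw [e]
  rw [integral_prod_mul (fun y => modGauss b y * conj (modGauss c (x.1 + y)))
    (fun y : ℝ => Complex.exp (-t * x.2 ^ 2) * (Complex.exp (-((s + t : ℝ) : ℂ) * y ^ 2) *
          poisson α (((-(2 * t * x.2) : ℝ) : ℂ) * y))), h1, integral_const_mul, h2]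
  have hne : (s : ℂ) + t ≠ 0 := by exact_mod_cast (add_pos hs ht).ne'
  have e2 : Complex.exp (-((s * t / (s + t) : ℝ) : ℂ) * (x.2 : ℂ) ^ 2) =
      Complex.exp (-t * x.2 ^ 2) *
        Complex.exp (((-(2 * t * x.2) : ℝ) : ℂ) ^ 2 / (4 * ((s + t : ℝ) : ℂ))) := by
    rw [← Complex.exp_add]
    congr 1
    push_cast
    field_simp
    ring
  rw [e2]
  ring

/-- The frequency-side counterpart, now at an imaginary frequency. It has the same profile in x, so
only constants remain to be compared. -/
lemma integral_gaussHat_mul_conj_mul_kernel {d : ℕ} {α : ℝ} (hα : -(1 / 2) < α)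
    (b c : EuclideanSpace ℝ (Fin d)) {s t : ℝ} (hs : 0 < s) (ht : 0 < t) (x : Space d) :
    ∫ ξ, gaussHat b s ξ * conj (gaussHat c t ξ) * kernel α x ξ ∂(μ d α) =
      gaussConst d α (1 / (4 * s) + 1 / (4 * t)) * (gaussCorrelation b c x.1 *
        Complex.exp (-((s * t / (s + t) : ℝ) : ℂ) * (x.2 : ℂ) ^ 2)) := by
  have h1 := integral_shiftGauss_mul_shiftGauss b c x.1
  have hp : 0 < 1 / (4 * s) + 1 / (4 * t) := by positivity
  have h2 := integral_gauss_mul_poisson d hα hp (Complex.I * x.2)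
  rw [μ_eq_prod]
  have e : ∀ y : Space d, gaussHat b s y * conj (gaussHat c t y) * kernel α x y =
      (shiftGauss b y.1 * conj (shiftGauss c y.1) *
        Complex.exp (-Complex.I * ((inner ℝ x.1 y.1 : ℝ) : ℂ))) *
      (Complex.exp (-((1 / (4 * s) + 1 / (4 * t) : ℝ) : ℂ) * y.2 ^ 2) *
        poisson α (Complex.I * x.2 * y.2)) := fun y => by
    have e1 : Complex.exp (-((1 / (4 * s) + 1 / (4 * t) : ℝ) : ℂ) * y.2 ^ 2) =
        Complex.exp (-((1 / (4 * s) : ℝ) : ℂ) * y.2 ^ 2) *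
          Complex.exp (-((1 / (4 * t) : ℝ) : ℂ) * y.2 ^ 2) := by
      rw [← Complex.exp_add]; congr 1; push_cast; ring
    rw [kernel_eq hα, gaussHat, gaussHat, e1, map_mul, conj_cexp_neg_mul_sq]
    ring
  simp_rw [e]
  rw [integral_prod_mul (fun y => shiftGauss b y * conj (shiftGauss c y) *
        Complex.exp (-Complex.I * ((inner ℝ x.1 y : ℝ) : ℂ)))
    (fun y : ℝ => Complex.exp (-((1 / (4 * s) + 1 / (4 * t) : ℝ) : ℂ) * y ^ 2) *
        poisson α (Complex.I * x.2 * y)), h1, h2]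
  have hs' : (s : ℂ) ≠ 0 := by exact_mod_cast hs.ne'
  have ht' : (t : ℂ) ≠ 0 := by exact_mod_cast ht.ne'
  have hne : (s : ℂ) + t ≠ 0 := by exact_mod_cast (add_pos hs ht).ne'
  have e2 : (Complex.I * x.2) ^ 2 / (4 * ((1 / (4 * s) + 1 / (4 * t) : ℝ) : ℂ)) =
      -((s * t / (s + t) : ℝ) : ℂ) * (x.2 : ℂ) ^ 2 := by
    have h3 : (4 * ((1 / (4 * s) + 1 / (4 * t) : ℝ) : ℂ)) = (s + t) / (s * t) := by
      push_cast
      field_simp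
      ring
    rw [h3, mul_pow, Complex.I_sq]
    push_cast
    field_simp
  rw [e2]
  ring

/-- The powers of s and t cancel, 4^{α+1} = 4 · 2^{2α}, and the remaining (2π)^d 2^{2α} Γ(α+1)² is
the inverse of `normConst d α`. This is where the normalization of μ enters. -/
lemma gaussConst_mul_gaussConst (d : ℕ) {α : ℝ} (hα : -(1 / 2) < α) {s t : ℝ} (hs : 0 < s)
    (ht : 0 < t) :
    (spatialConst d * gaussConst d α s) * (spatialConst d * gaussConst d α t) *
      gaussConst d α (1 / (4 * s) + 1 / (4 * t)) = normConst d α * gaussConst d α (s + t) := by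
  have hG : 0 < Real.Gamma (α + 1) := Real.Gamma_pos_of_pos (by linarith)
  have hpi := Real.pi_pos
  have e1 : spatialConst d * spatialConst d = (2 * Real.pi) ^ d := by
    rw [spatialConst, ← Real.rpow_add (by positivity), add_halves, Real.rpow_natCast]
  have e2 : (1 / (4 * s) + 1 / (4 * t)) = (s + t) / (4 * (s * t)) := by
    field_simp
    ring
  have e3 : (4 : ℝ) ^ (α + 1) = 4 * 2 ^ (2 * α) := by
    rw [show (4 : ℝ) = 2 ^ (2 : ℝ) by norm_num, ← Real.rpow_mul (by norm_num),
      ← Real.rpow_add (by norm_num)]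
    congr 1
    ring
  have h1 : 0 < s ^ (α + 1) := by positivity
  have h2 : 0 < t ^ (α + 1) := by positivity
  have h3 : 0 < (s + t) ^ (α + 1) := by positivity
  have h4 : (0 : ℝ) < 2 ^ (2 * α) := by positivity
  rw [mul_mul_mul_comm, e1]
  unfold gaussConst
  rw [e2, Real.div_rpow (by positivity) (by positivity), Real.mul_rpow (by norm_num)
    (by positivity), Real.mul_rpow hs.le ht.le, e3, normConst]
  generalize Real.Gamma (α + 1) = A at *
  generalize s ^ (α + 1) = B at *
  generalize t ^ (α + 1) = D at *
  generalize (s + t) ^ (α + 1) = E at *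
  generalize (2 : ℝ) ^ (2 * α) = P at *
  field_simp
  ring

/-- The correlation identity for Gaussians. -/
lemma normConst_mul_integral_gauss {d : ℕ} {α : ℝ} (hα : -(1 / 2) < α)
    (b c : EuclideanSpace ℝ (Fin d)) {s t : ℝ} (hs : 0 < s) (ht : 0 < t) (x : Space d) :
    (normConst d α : ℂ) *
      ∫ y, gauss b s y * conj (∫ θ, gauss c t (shift x (y, θ)) ∂(angleMeasure α)) ∂(μ d α) =
    ∫ ξ, fourierIntegral α (gauss b s) ξ * conj (fourierIntegral α (gauss c t) ξ) *
      kernel α x ξ ∂(μ d α) := by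
  rw [integral_gauss_mul_conj_translate hα b c hs ht]
  have e : ∀ ξ : Space d, fourierIntegral α (gauss b s) ξ *
      conj (fourierIntegral α (gauss c t) ξ) * kernel α x ξ =
      (((spatialConst d * gaussConst d α s : ℝ) : ℂ) *
        ((spatialConst d * gaussConst d α t : ℝ) : ℂ)) *
      (gaussHat b s ξ * conj (gaussHat c t ξ) * kernel α x ξ) := fun ξ => by
    rw [fourierIntegral_gauss hα b hs, fourierIntegral_gauss hα c ht, map_mul,
      Complex.conj_ofReal]
    ring
  simp_rw [e]
  rw [integral_const_mul, integral_gaussHat_mul_conj_mul_kernel hα b c hs ht,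
    ← mul_assoc (normConst d α : ℂ), ← mul_assoc (_ * _) (gaussConst d α _ : ℂ),
    ← Complex.ofReal_mul, ← Complex.ofReal_mul, ← Complex.ofReal_mul,
    gaussConst_mul_gaussConst d hα hs ht]

lemma kernel_zero_left {d : ℕ} {α : ℝ} (hα : -(1 / 2) < α) (ξ : Space d) :
    kernel α 0 ξ = 1 := by
  simp [kernel_eq hα, poisson_zero hα]

/-- The Parseval identity for Gaussians. -/
lemma parseval_gauss {d : ℕ} {α : ℝ} (hα : -(1 / 2) < α)
    (b c : EuclideanSpace ℝ (Fin d)) {s t : ℝ} (hs : 0 < s) (ht : 0 < t) :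
    ∫ ξ, fourierIntegral α (gauss b s) ξ * conj (fourierIntegral α (gauss c t) ξ) ∂(μ d α) =
    (normConst d α : ℂ) * ∫ y, gauss b s y * conj (gauss c t y) ∂(μ d α) := by
  have := isProbabilityMeasure_angleMeasure hα
  -- At x = 0 the kernel is 1 and translation fixes a Gaussian, which is even in the last variable.
  -- The correlation identity needs no positivity of x, so the boundary point is allowed.
  have h := normConst_mul_integral_gauss hα b c hs ht 0
  have e : ∀ (y : Space d) (θ : ℝ), gauss c t (shift 0 (y, θ)) = gauss c t y := fun y θ => by
    have h1 : (shift 0 (y, θ)).1 = y.1 := by simp [shift]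
    have h2 := congrArg (fun r : ℝ => (r : ℂ)) (sq_shift_snd 0 (y, θ))
    dsimp only at h2
    rw [Complex.ofReal_pow] at h2
    rw [gauss, gauss, h1, h2]
    simp
  simp only [e, kernel_zero_left hα, mul_one, integral_const, probReal_univ, one_smul] at h
  exact h.symm

/-- The Hankel formula produces exp(s x_{d+1}²), which cancels the factor exp(-s x_{d+1}²) of the
translate. -/
lemma integral_shift_gauss {d : ℕ} {α : ℝ} (hα : -(1 / 2) < α)
    (b : EuclideanSpace ℝ (Fin d)) {s : ℝ} (hs : 0 < s) (x : Space d) :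
    ∫ y, ∫ θ, gauss b s (shift x (y, θ)) ∂(angleMeasure α) ∂(μ d α) =
      ∫ y, gauss b s y ∂(μ d α) := by
  have h2 := integral_gauss_mul_poisson d hα hs ((-(2 * s * x.2) : ℝ) : ℂ)
  have h3 := integral_gauss_mul_poisson d hα hs 0
  simp only [zero_mul, poisson_zero hα, mul_one] at h3
  simp_rw [integral_gauss_shift]
  unfold gauss
  rw [μ_eq_prod, integral_prod_mul (fun y => modGauss b (x.1 + y)) (fun y : ℝ =>
    Complex.exp (-s * x.2 ^ 2) * (Complex.exp (-s * y ^ 2) *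
      poisson α (((-(2 * s * x.2) : ℝ) : ℂ) * y))),
    integral_prod_mul (fun y => modGauss b y) (fun y : ℝ => Complex.exp (-s * y ^ 2)),
    integral_add_left_eq_self (modGauss b), integral_const_mul, h2, h3,
    mul_left_comm (Complex.exp _),
    ← Complex.exp_add]
  congr 4
  have hs' : (s : ℂ) ≠ 0 := by exact_mod_cast hs.ne'
  push_cast
  field_simp
  ring

lemma integrable_gauss_comp_shift {d : ℕ} {α : ℝ} (hα : -(1 / 2) < α)
    (b : EuclideanSpace ℝ (Fin d)) {s : ℝ} (hs : 0 < s) (x : Space d) :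
    Integrable (fun p => gauss b s (shift x p)) ((μ d α).prod (angleMeasure α)) := by
  have := isProbabilityMeasure_angleMeasure hα
  have h : Integrable (fun y : Space d => ‖modGauss b (x.1 + y.1)‖ *
      Real.exp (-s * y.2 ^ 2 + 2 * s * |x.2| * y.2)) (μ d α) := by
    rw [μ_eq_prod]
    exact ((integrable_modGauss b).comp_add_left x.1).norm.mul_prod
      (integrable_exp_mul_exp_radial d hα hs (2 * s * |x.2|))
  have hm : AEStronglyMeasurable (fun p => gauss b s (shift x p))
      ((μ d α).prod (angleMeasure α)) :=
    ((continuous_gauss b s).comp (continuous_shift.comp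
      (Continuous.prodMk_right x))).aestronglyMeasurable
  refine (h.comp_fst (angleMeasure α)).mono' hm ?_
  have hpos : ∀ᵐ p ∂((μ d α).prod (angleMeasure α)), 0 < p.1.2 :=
    Measure.quasiMeasurePreserving_fst.ae (ae_mem_halfSpace d α)
  refine hpos.mono fun p hp => ?_
  rw [norm_gauss, sq_shift_snd, norm_modGauss]
  refine mul_le_mul_of_nonneg_left (Real.exp_le_exp.2 ?_) (Real.exp_pos _).le
  have h1 : -(x.2 * Real.cos p.2) ≤ |x.2| := by
    refine (neg_le_abs _).trans ?_
    rw [abs_mul]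
    exact mul_le_of_le_one_right (abs_nonneg _) (Real.abs_cos_le_one _)
  have h2 := mul_le_mul_of_nonneg_left h1 (by positivity : 0 ≤ 2 * s * p.1.2)
  have h3 := mul_nonneg hs.le (sq_nonneg x.2)
  linarith

/-! ### Gaussians determine measures and functions. -/

open BoundedContinuousFunction in
/-- Finite measures on a Polish space agree when they agree on a star-closed submonoid of bounded
continuous functions that separates points. -/
theorem measure_ext_of_submonoid {E : Type*} [TopologicalSpace E] [PolishSpace E]
    [MeasurableSpace E] [BorelSpace E] {P P' : Measure E} [IsFiniteMeasure P] [IsFiniteMeasure P']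
    (S : Submonoid (E →ᵇ ℂ)) (hstar : ∀ f ∈ S, star f ∈ S)
    (hsep : ∀ x y : E, x ≠ y → ∃ f ∈ S, f x ≠ f y)
    (h : ∀ f ∈ S, ∫ x, f x ∂P = ∫ x, f x ∂P') : P = P' := by
  refine ext_of_forall_mem_subalgebra_integral_eq_of_polish (𝕜 := ℂ)
    (A := StarAlgebra.adjoin ℂ (S : Set (E →ᵇ ℂ))) ?_ ?_
  · intro x y hxy
    obtain ⟨f, hf, hne⟩ := hsep x y hxy
    refine ⟨f, ⟨f.toContinuousMap, ⟨f, ?_, rfl⟩, rfl⟩, hne⟩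
    exact StarAlgebra.subset_adjoin ℂ _ hf
  · intro g hg
    have hS : (S : Set (E →ᵇ ℂ)) ∪ star (S : Set (E →ᵇ ℂ)) = S := by
      refine union_eq_self_of_subset_right fun f hf => ?_
      simpa using hstar _ hf
    -- A star-closed submonoid generates a star algebra equal to its linear span, so linearity of
    -- the integral suffices.
    have hg' : g ∈ Submodule.span ℂ (S : Set (E →ᵇ ℂ)) := by
      have h1 : g ∈ Subalgebra.toSubmodule
          (StarAlgebra.adjoin ℂ (S : Set (E →ᵇ ℂ))).toSubalgebra := hg
      rwa [StarAlgebra.adjoin_eq_span, hS, Submonoid.closure_eq] at h1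
    clear hg
    induction hg' using Submodule.span_induction with
    | mem f hf => exact h f hf
    | zero => simp
    | add f f' _ _ hf hf' =>
      have e : ∀ m : Measure E, IsFiniteMeasure m → ∫ x, (f + f') x ∂m =
          ∫ x, f x ∂m + ∫ x, f' x ∂m := fun m _ =>
        integral_add (f.integrable m) (f'.integrable m)
      rw [e P inferInstance, e P' inferInstance, hf, hf']
    | smul c f _ hf =>
      have e : ∀ m : Measure E, ∫ x, (c • f) x ∂m = c * ∫ x, f x ∂m := fun m =>
        integral_const_mul c _
      rw [e P, e P', hf]

/-- The functions `exp(i⟨b, x'⟩ - s x_{d+1}²)` on the half-space. -/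
def expChar {d : ℕ} (b : EuclideanSpace ℝ (Fin d)) (s : NNReal) :
    BoundedContinuousFunction (halfSpace d) ℂ :=
  BoundedContinuousFunction.ofNormedAddCommGroup
    (fun x => Complex.exp (Complex.I * ((inner ℝ b x.1.1 : ℝ) : ℂ)) *
      Complex.exp (-((s : ℝ) : ℂ) * (x.1.2 : ℂ) ^ 2)) (by fun_prop) 1 (fun x => by
        rw [norm_mul, mul_comm Complex.I, Complex.norm_exp_ofReal_mul_I, one_mul,
          norm_cexp_neg_mul_sq, Real.exp_le_one_iff]
        have : 0 ≤ (s : ℝ) * x.1.2 ^ 2 := by positivity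
        linarith)

lemma expChar_apply {d : ℕ} (b : EuclideanSpace ℝ (Fin d)) (s : NNReal) (x : halfSpace d) :
    expChar b s x = Complex.exp (Complex.I * ((inner ℝ b x.1.1 : ℝ) : ℂ)) *
      Complex.exp (-((s : ℝ) : ℂ) * (x.1.2 : ℂ) ^ 2) := rfl

/-- The submonoid formed by the functions `expChar b s`. -/
def expCharSubmonoid (d : ℕ) : Submonoid (BoundedContinuousFunction (halfSpace d) ℂ) where
  carrier := range fun p : EuclideanSpace ℝ (Fin d) × NNReal => expChar p.1 p.2
  mul_mem' := by
    rintro _ _ ⟨⟨b, s⟩, rfl⟩ ⟨⟨c, t⟩, rfl⟩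
    refine ⟨(b + c, s + t), ?_⟩
    ext x
    simp only [BoundedContinuousFunction.mul_apply, expChar_apply, ← Complex.exp_add]
    rw [inner_add_left]
    congr 1
    push_cast
    ring
  one_mem' := by
    refine ⟨(0, 0), ?_⟩
    ext x
    simp [expChar_apply]

lemma exists_expChar_ne {d : ℕ} {x y : halfSpace d} (hxy : x ≠ y) :
    ∃ (b : EuclideanSpace ℝ (Fin d)) (s : NNReal), expChar b s x ≠ expChar b s y := by
  by_cases h : x.1.1 = y.1.1
  -- The exponential only sees the square of the last coordinate; positivity on the half-space
  -- recovers the coordinate itself.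
  · refine ⟨0, 1, fun he => hxy ?_⟩
    simp only [expChar_apply, inner_zero_left, Complex.ofReal_zero, mul_zero, Complex.exp_zero,
      one_mul] at he
    have h1 := congrArg norm he
    rw [norm_cexp_neg_mul_sq, norm_cexp_neg_mul_sq, Real.exp_eq_exp] at h1
    have hx : 0 < x.1.2 := x.2
    have hy : 0 < y.1.2 := y.2
    have h2 : x.1.2 ^ 2 = y.1.2 ^ 2 := by simpa using h1
    have h3 : x.1.2 = y.1.2 := by
      rwa [sq_eq_sq₀ hx.le hy.le] at h2
    exact Subtype.ext (Prod.ext h h3)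
  · set v := x.1.1 - y.1.1 with hv
    have hv0 : ‖v‖ ^ 2 ≠ 0 := by
      rw [hv]
      exact pow_ne_zero _ (norm_ne_zero_iff.2 (sub_ne_zero.2 h))
    -- This frequency makes the phases at the two points differ by π, so the values have opposite
    -- signs.
    refine ⟨(Real.pi / ‖v‖ ^ 2) • v, 0, fun he => ?_⟩
    simp only [expChar_apply, NNReal.coe_zero, Complex.ofReal_zero, neg_zero, zero_mul,
      Complex.exp_zero, mul_one] at he
    have hx : x.1.1 = y.1.1 + v := by rw [hv]; abel
    rw [hx, inner_add_right, inner_smul_left v v, real_inner_self_eq_norm_sq, Complex.ofReal_add,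
      mul_add, Complex.exp_add] at he
    simp only [conj_trivial, div_mul_cancel₀ _ hv0] at he
    rw [mul_comm Complex.I (Real.pi : ℂ), Complex.exp_pi_mul_I] at he
    have := Complex.exp_ne_zero (Complex.I * ((inner ℝ ((Real.pi / ‖v‖ ^ 2) • v) y.1.1 : ℝ) : ℂ))
    exact this (by linear_combination -(1 / 2 : ℂ) * he)

lemma gauss_one_add {d : ℕ} (b : EuclideanSpace ℝ (Fin d)) (s : NNReal) (x : halfSpace d) :
    gauss b (1 + s) x.1 = ((‖gauss 0 1 x.1‖ : ℝ) : ℂ) * expChar b s x := by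
  have e1 : (-(1 / 2 : ℂ) * (‖x.1.1‖ : ℂ) ^ 2) = ((-(1 / 2) * ‖x.1.1‖ ^ 2 : ℝ) : ℂ) := by
    push_cast; ring
  rw [norm_gauss, expChar_apply, gauss, modGauss, Complex.exp_add, e1,
    Complex.ofReal_mul (Real.exp _), Complex.ofReal_exp, Complex.ofReal_exp]
  have e2 : Complex.exp (-((1 + (s : ℝ) : ℝ) : ℂ) * (x.1.2 : ℂ) ^ 2) =
      Complex.exp ((-1 * x.1.2 ^ 2 : ℝ) : ℂ) * Complex.exp (-((s : ℝ) : ℂ) * (x.1.2 : ℂ) ^ 2) := by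
    rw [← Complex.exp_add]; congr 1; push_cast; ring
  rw [e2]
  ring

/-- Measures on the half-space are determined by their Gaussian integrals. -/
theorem measure_ext_of_gauss {d : ℕ} {m m' : Measure (Space d)}
    (hm : ∀ᵐ x ∂m, 0 < x.2) (hm' : ∀ᵐ x ∂m', 0 < x.2)
    (hi : Integrable (gauss (d := d) 0 1) m) (hi' : Integrable (gauss (d := d) 0 1) m')
    (h : ∀ (b : EuclideanSpace ℝ (Fin d)) (s : ℝ), 0 < s →
      ∫ x, gauss b s x ∂m = ∫ x, gauss b s x ∂m') : m = m' := by
  -- The measures may be infinite, so both are weighted by a positive Gaussian. Weighted integrals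
  -- of `expChar b s` are integrals of `gauss b (1 + s)`, and the weight is divided out at the end.
  set w : Space d → ENNReal := fun x => ENNReal.ofReal ‖gauss 0 1 x‖ with hw
  have hwm : Measurable w := (continuous_gauss 0 1).norm.measurable.ennreal_ofReal
  have hH := measurableSet_halfSpace d
  have hfin : ∀ n : Measure (Space d), Integrable (gauss (d := d) 0 1) n →
      IsFiniteMeasure (n.withDensity w) := fun n hn =>
    isFiniteMeasure_withDensity_ofReal hn.norm.2
  have hPf := hfin m hi
  have hPf' := hfin m' hi'
  have hpol : PolishSpace (halfSpace d) :=
    (isOpen_lt continuous_const continuous_snd : IsOpen (halfSpace d)).polishSpace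
  have hemb := MeasurableEmbedding.subtype_coe hH
  have hcf : ∀ n : Measure (Space d), IsFiniteMeasure n →
      IsFiniteMeasure (n.comap (Subtype.val : halfSpace d → Space d)) := fun n _ =>
    ⟨by rw [hemb.comap_apply]; exact measure_lt_top _ _⟩
  have := hcf _ hPf
  have := hcf _ hPf'
  have hres : ∀ n : Measure (Space d), (∀ᵐ x ∂n, 0 < x.2) →
      (n.withDensity w).restrict (halfSpace d) = n.withDensity w := fun n hn =>
    Measure.restrict_eq_self_of_ae_mem ((withDensity_absolutelyContinuous n w).ae_le hn)
  have hint : ∀ n : Measure (Space d), (∀ᵐ x ∂n, 0 < x.2) →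
      ∀ (b : EuclideanSpace ℝ (Fin d)) (s : NNReal),
      ∫ x, expChar b s x ∂((n.withDensity w).comap (Subtype.val : halfSpace d → Space d)) =
        ∫ x, gauss b (1 + s) x ∂n := fun n hn b s => by
    have h1 := integral_subtype_comap (μ := n.withDensity w) hH (fun x : Space d =>
      Complex.exp (Complex.I * ((inner ℝ b x.1 : ℝ) : ℂ)) *
        Complex.exp (-((s : ℝ) : ℂ) * (x.2 : ℂ) ^ 2))
    rw [hres n hn, integral_withDensity_eq_integral_toReal_smul hwm (by simp [hw])] at h1
    simp only [expChar_apply]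
    rw [h1]
    refine integral_congr_ae (hn.mono fun x hx => ?_)
    dsimp only
    rw [gauss_one_add b s ⟨x, hx⟩, hw, ENNReal.toReal_ofReal (norm_nonneg _), Complex.real_smul]
    rfl
  have key : (m.withDensity w).comap (Subtype.val : halfSpace d → Space d) =
      (m'.withDensity w).comap (Subtype.val : halfSpace d → Space d) := by
    refine measure_ext_of_submonoid (expCharSubmonoid d) ?_ ?_ ?_
    · rintro _ ⟨⟨b, s⟩, rfl⟩
      refine ⟨(-b, s), ?_⟩
      ext x
      simp only [BoundedContinuousFunction.star_apply, expChar_apply, inner_neg_left,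
        Complex.star_def, map_mul, conj_cexp_neg_mul_sq]
      rw [← Complex.exp_conj, map_mul, Complex.conj_I, Complex.conj_ofReal]
      congr 2
      push_cast
      ring
    · intro x y hxy
      obtain ⟨b, s, hne⟩ := exists_expChar_ne hxy
      exact ⟨_, ⟨(b, s), rfl⟩, hne⟩
    · rintro _ ⟨⟨b, s⟩, rfl⟩
      dsimp only
      rw [hint m hm, hint m' hm']
      exact h b _ (by positivity)
  have hP : m.withDensity w = m'.withDensity w := by
    rw [← hres m hm, ← hres m' hm', ← map_comap_subtype_coe hH, ← map_comap_subtype_coe hH, key]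
  have hinv : ∀ n : Measure (Space d), (n.withDensity w).withDensity w⁻¹ = n := fun n => by
    refine withDensity_inv_same hwm (ae_of_all _ fun x => ?_) (ae_of_all _ fun x => ?_)
    · rw [hw]
      simp only [ne_eq, ENNReal.ofReal_eq_zero, not_le]
      rw [norm_gauss]
      positivity
    · simp [hw]
  rw [← hinv m, ← hinv m', hP]

lemma conj_gauss {d : ℕ} (b : EuclideanSpace ℝ (Fin d)) (s : ℝ) (x : Space d) :
    conj (gauss b s x) = gauss (-b) s x := by
  rw [gauss, gauss, map_mul, conj_cexp_neg_mul_sq, modGauss, modGauss, ← Complex.exp_conj]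
  simp only [map_add, map_mul, map_neg, map_div₀, map_one, map_ofNat, map_pow, Complex.conj_ofReal,
    Complex.conj_I, inner_neg_left, Complex.ofReal_neg, mul_neg, neg_mul]

lemma integrable_mul_gauss {d : ℕ} {m : Measure (Space d)} {h : Space d → ℂ}
    (hm : AEStronglyMeasurable h m) {s : ℝ}
    (hi : Integrable (fun x => h x * gauss 0 s x) m) (b : EuclideanSpace ℝ (Fin d)) :
    Integrable (fun x => h x * gauss b s x) m := by
  refine hi.mono (hm.mul (continuous_gauss b s).aestronglyMeasurable) (ae_of_all _ fun x => ?_)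
  rw [norm_mul, norm_mul, norm_gauss, norm_gauss]

/-- The positive and negative parts of r are densities of two measures with equal Gaussian
integrals, so they coincide; since at most one part is nonzero at each point, both vanish. -/
lemma ae_eq_zero_of_integral_gauss_real {d : ℕ} {m : Measure (Space d)} [SigmaFinite m]
    (hpos : ∀ᵐ x ∂m, 0 < x.2) {r : Space d → ℝ} (hr : Measurable r)
    (hi : ∀ s : ℝ, 0 < s → Integrable (fun x => (r x : ℂ) * gauss 0 s x) m)
    (h0 : ∀ (b : EuclideanSpace ℝ (Fin d)) (s : ℝ), 0 < s →
      ∫ x, (r x : ℂ) * gauss b s x ∂m = 0) : r =ᵐ[m] 0 := by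
  have hi2 : ∀ (q : Space d → ℝ), Measurable q → (∀ x, |q x| = |r x|) → ∀ b (s : ℝ), 0 < s →
      Integrable (fun x => (ENNReal.ofReal (q x)).toReal • gauss b s x) m :=
    fun q hq hqr b s hs => by
    refine (integrable_mul_gauss (by fun_prop) (hi s hs) b).mono
      ((by fun_prop : Measurable fun x => (ENNReal.ofReal (q x)).toReal).aestronglyMeasurable.smul
        (continuous_gauss b s).aestronglyMeasurable) (ae_of_all _ fun x => ?_)
    rw [norm_smul, norm_mul, Complex.norm_real, Real.norm_eq_abs (r x), ← hqr,
      ENNReal.toReal_ofReal', Real.norm_eq_abs]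
    refine mul_le_mul_of_nonneg_right ?_ (norm_nonneg _)
    rw [abs_of_nonneg (le_max_right _ _)]
    exact max_le (le_abs_self _) (abs_nonneg _)
  have hrn := hi2 r hr fun _ => rfl
  have hrn' := hi2 (fun x => -r x) hr.neg fun _ => abs_neg _
  have hac := fun q : Space d → ℝ =>
    withDensity_absolutelyContinuous m fun x => ENNReal.ofReal (q x)
  have key : (m.withDensity fun x => ENNReal.ofReal (r x)) =
      m.withDensity fun x => ENNReal.ofReal (-r x) := by
    refine measure_ext_of_gauss ((hac r).ae_le hpos) ((hac fun x => -r x).ae_le hpos) ?_ ?_ ?_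
    · rw [integrable_withDensity_iff_integrable_smul' (by fun_prop) (by simp)]
      exact hrn 0 1 one_pos
    · rw [integrable_withDensity_iff_integrable_smul' (by fun_prop) (by simp)]
      exact hrn' 0 1 one_pos
    · intro b s hs
      rw [integral_withDensity_eq_integral_toReal_smul (by fun_prop) (by simp),
        integral_withDensity_eq_integral_toReal_smul (by fun_prop) (by simp), ← sub_eq_zero,
        ← integral_sub (hrn b s hs) (hrn' b s hs), ← h0 b s hs]
      refine integral_congr_ae (ae_of_all _ fun x => ?_)
      dsimp only
      rw [ENNReal.toReal_ofReal', ENNReal.toReal_ofReal', ← sub_smul, Complex.real_smul]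
      congr 2
      rcases le_total 0 (r x) with h | h
      · rw [max_eq_left h, max_eq_right (by linarith), sub_zero]
      · rw [max_eq_right h, max_eq_left (by linarith), zero_sub, neg_neg]
  rw [withDensity_eq_iff_of_sigmaFinite (by fun_prop) (by fun_prop)] at key
  refine key.mono fun x hx => ?_
  dsimp only at hx
  rcases lt_trichotomy (r x) 0 with h | h | h
  · rw [ENNReal.ofReal_of_nonpos h.le, eq_comm, ENNReal.ofReal_eq_zero] at hx
    linarith
  · exact h
  · rw [ENNReal.ofReal_of_nonpos (by linarith : -r x ≤ 0), ENNReal.ofReal_eq_zero] at hx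
    linarith

/-- A function on the half-space all of whose Gaussian integrals vanish is zero. -/
theorem ae_eq_zero_of_integral_gauss {d : ℕ} {m : Measure (Space d)} [SigmaFinite m]
    (hpos : ∀ᵐ x ∂m, 0 < x.2) {h : Space d → ℂ} (hm : AEStronglyMeasurable h m)
    (hi : ∀ s : ℝ, 0 < s → Integrable (fun x => h x * gauss 0 s x) m)
    (h0 : ∀ (b : EuclideanSpace ℝ (Fin d)) (s : ℝ), 0 < s →
      ∫ x, h x * gauss b s x ∂m = 0) : h =ᵐ[m] 0 := by
  obtain ⟨k, hk, hhk⟩ := hm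
  have hi' : ∀ (s : ℝ), 0 < s → ∀ b : EuclideanSpace ℝ (Fin d),
      Integrable (fun x => k x * gauss b s x) m := fun s hs b => by
    refine integrable_mul_gauss hk.aestronglyMeasurable ((hi s hs).congr ?_) b
    filter_upwards [hhk] with x hx
    rw [hx]
  have h0' : ∀ (b : EuclideanSpace ℝ (Fin d)) (s : ℝ), 0 < s →
      ∫ x, k x * gauss b s x ∂m = 0 := fun b s hs => by
    rw [← h0 b s hs]
    refine integral_congr_ae ?_
    filter_upwards [hhk] with x hx
    rw [hx]
  have hic : ∀ (s : ℝ), 0 < s → ∀ b : EuclideanSpace ℝ (Fin d),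
      Integrable (fun x => conj (k x) * gauss b s x) m := fun s hs b => by
    refine (hi' s hs b).mono ?_ (ae_of_all _ fun x => by simp)
    exact ((Complex.continuous_conj.comp_stronglyMeasurable hk).mul
      (continuous_gauss b s).stronglyMeasurable).aestronglyMeasurable
  -- Conjugation sends b to -b, so the family of test Gaussians is stable and the real and imaginary
  -- parts can be treated separately.
  have h0c : ∀ (b : EuclideanSpace ℝ (Fin d)) (s : ℝ), 0 < s →
      ∫ x, conj (k x) * gauss b s x ∂m = 0 := fun b s hs => by
    have := congrArg conj (h0' (-b) s hs)
    rw [← integral_conj, map_zero] at this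
    simpa only [map_mul, conj_gauss, neg_neg] using this
  have hre : (fun x => (k x).re) =ᵐ[m] 0 := by
    have e : ∀ b s x, (((k x).re : ℝ) : ℂ) * gauss b s x =
        (1 / 2 : ℂ) * (k x * gauss b s x + conj (k x) * gauss b s x) := fun b s x => by
      rw [← add_mul, Complex.add_conj]
      push_cast
      ring
    refine ae_eq_zero_of_integral_gauss_real hpos (Complex.measurable_re.comp hk.measurable) ?_ ?_
    · intro s hs
      simp_rw [e]
      exact ((hi' s hs 0).add (hic s hs 0)).const_mul _
    · intro b s hs
      simp_rw [e]
      rw [integral_const_mul, integral_add (hi' s hs b) (hic s hs b), h0' b s hs, h0c b s hs,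
        add_zero, mul_zero]
  have him : (fun x => (k x).im) =ᵐ[m] 0 := by
    have e : ∀ b s x, (((k x).im : ℝ) : ℂ) * gauss b s x =
        (-Complex.I / 2) * (k x * gauss b s x - conj (k x) * gauss b s x) := fun b s x => by
      rw [← sub_mul, Complex.sub_conj]
      push_cast
      linear_combination ((k x).im * gauss b s x) * Complex.I_sq
    refine ae_eq_zero_of_integral_gauss_real hpos (Complex.measurable_im.comp hk.measurable) ?_ ?_
    · intro s hs
      simp_rw [e]
      exact ((hi' s hs 0).sub (hic s hs 0)).const_mul _
    · intro b s hs
      simp_rw [e]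
      rw [integral_const_mul, integral_sub (hi' s hs b) (hic s hs b), h0' b s hs, h0c b s hs,
        sub_zero, mul_zero]
  filter_upwards [hhk, hre, him] with x h1 h2 h3
  rw [h1]
  exact Complex.ext h2 h3

/-! ### The Weinstein transform on L². -/

/-- The Hilbert space `L²_α`. -/
abbrev L2 (d : ℕ) (α : ℝ) : Type := Lp ℂ 2 (μ d α)

/-- The parameters of the Gaussians `gauss b s`. -/
abbrev GaussIndex (d : ℕ) : Type := EuclideanSpace ℝ (Fin d) × {s : ℝ // 0 < s}

lemma inner_Lp_eq {X : Type*} [MeasurableSpace X] {m : Measure X} (f g : Lp ℂ 2 m) :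
    inner ℂ f g = ∫ x, g x * conj (f x) ∂m := rfl

lemma inner_toLp_left {X : Type*} [MeasurableSpace X] {m : Measure X} {f : X → ℂ}
    (hf : MemLp f 2 m) (g : Lp ℂ 2 m) :
    inner ℂ (hf.toLp f) g = ∫ x, g x * conj (f x) ∂m := by
  rw [inner_Lp_eq]
  refine integral_congr_ae ?_
  filter_upwards [hf.coeFn_toLp] with x hx
  rw [hx]

lemma inner_toLp_toLp {X : Type*} [MeasurableSpace X] {m : Measure X} {f g : X → ℂ}
    (hf : MemLp f 2 m) (hg : MemLp g 2 m) :
    inner ℂ (hf.toLp f) (hg.toLp g) = ∫ x, g x * conj (f x) ∂m := by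
  rw [inner_toLp_left]
  refine integral_congr_ae ?_
  filter_upwards [hg.coeFn_toLp] with x hx
  rw [hx]

/-- The Gaussians as elements of `L²_α`. -/
def gaussL2 {d : ℕ} {α : ℝ} (hα : -(1 / 2) < α) (i : GaussIndex d) : L2 d α :=
  (memLp_gauss hα i.1 i.2.2).toLp

lemma memLp_fourierIntegral_gauss {d : ℕ} {α : ℝ} (hα : -(1 / 2) < α)
    (b : EuclideanSpace ℝ (Fin d)) {s : ℝ} (hs : 0 < s) :
    MemLp (fourierIntegral α (gauss b s)) 2 (μ d α) := by
  rw [funext (fourierIntegral_gauss hα b hs)]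
  exact (memLp_gaussHat hα b hs).const_mul _

/-- The transforms of the Gaussians as elements of `L²_α`. -/
def gaussTransformL2 {d : ℕ} {α : ℝ} (hα : -(1 / 2) < α) (i : GaussIndex d) : L2 d α :=
  (memLp_fourierIntegral_gauss hα i.1 i.2.2).toLp

lemma inner_gaussTransformL2 {d : ℕ} {α : ℝ} (hα : -(1 / 2) < α) (i j : GaussIndex d) :
    inner ℂ (gaussTransformL2 hα i) (gaussTransformL2 hα j) =
      (normConst d α : ℂ) * inner ℂ (gaussL2 hα i) (gaussL2 hα j) := by
  rw [gaussTransformL2, gaussTransformL2, gaussL2, gaussL2, inner_toLp_toLp, inner_toLp_toLp]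
  exact parseval_gauss hα j.1 i.1 j.2.2 i.2.2

lemma integrable_mul_gauss_of_memLp {d : ℕ} {α : ℝ} (hα : -(1 / 2) < α) {f : Space d → ℂ}
    (hf : MemLp f 2 (μ d α)) (b : EuclideanSpace ℝ (Fin d)) {s : ℝ} (hs : 0 < s) :
    Integrable (fun x => f x * gauss b s x) (μ d α) :=
  hf.integrable_mul (memLp_gauss hα b hs)

/-- A vector orthogonal to all Gaussians has vanishing Gaussian integrals, hence is zero. -/
lemma dense_span_gaussL2 {d : ℕ} {α : ℝ} (hα : -(1 / 2) < α) :
    Dense (Submodule.span ℂ (range (gaussL2 (d := d) hα)) : Set (L2 d α)) := by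
  rw [Submodule.dense_iff_topologicalClosure_eq_top, Submodule.topologicalClosure_eq_top_iff,
    Submodule.eq_bot_iff]
  intro f hf
  rw [Submodule.mem_orthogonal] at hf
  rw [Lp.eq_zero_iff_ae_eq_zero]
  refine ae_eq_zero_of_integral_gauss (ae_mem_halfSpace d α) (Lp.memLp f).1
    (fun s hs => integrable_mul_gauss_of_memLp hα (Lp.memLp f) 0 hs) fun b s hs => ?_
  have h := hf (gaussL2 hα (-b, ⟨s, hs⟩)) (Submodule.subset_span ⟨_, rfl⟩)
  rw [gaussL2, inner_toLp_left] at h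
  simpa only [conj_gauss, neg_neg] using h

/-- Vectors with proportional Gram matrices are related by a bounded operator. -/
lemma exists_clm_of_gram {E F ι : Type*} [NormedAddCommGroup E] [InnerProductSpace ℂ E]
    [NormedAddCommGroup F] [InnerProductSpace ℂ F] [CompleteSpace F] {a : ι → E} {b : ι → F}
    (ha : Dense (Submodule.span ℂ (range a) : Set E)) {K : ℝ} (hK : 0 ≤ K)
    (h : ∀ i j, inner ℂ (b i) (b j) = (K : ℂ) * inner ℂ (a i) (a j)) :
    ∃ T : E →L[ℂ] F, ∀ i, T (a i) = b i := by
  have hgram : ∀ c c' : ι →₀ ℂ,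
      inner ℂ (Finsupp.linearCombination ℂ b c) (Finsupp.linearCombination ℂ b c') =
      (K : ℂ) * inner ℂ (Finsupp.linearCombination ℂ a c) (Finsupp.linearCombination ℂ a c') := by
    intro c c'
    induction c using Finsupp.induction_linear with
    | zero => simp
    | add f g hf hg => simp only [map_add, inner_add_left, hf, hg, mul_add]
    | single i z =>
      induction c' using Finsupp.induction_linear with
      | zero => simp
      | add f g hf hg => simp only [map_add, inner_add_right, hf, hg, mul_add]
      | single j w =>
        simp only [Finsupp.linearCombination_single, inner_smul_left, inner_smul_right, h]
        ring
  -- The Gram relation bounds each combination of the b by the same combination of the a. Linear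
  -- relations among the a thus persist, and the map extends by density.
  have hnorm : ∀ c : ι →₀ ℂ, ‖Finsupp.linearCombination ℂ b c‖ ≤
      √K * ‖Finsupp.linearCombination ℂ a c‖ := fun c => by
    have h1 := congrArg Complex.re (hgram c c)
    rw [Complex.re_ofReal_mul] at h1
    have h2 : ‖Finsupp.linearCombination ℂ b c‖ ^ 2 =
        K * ‖Finsupp.linearCombination ℂ a c‖ ^ 2 := by
      rw [← inner_self_eq_norm_sq (𝕜 := ℂ), ← inner_self_eq_norm_sq (𝕜 := ℂ)]
      exact h1
    refine le_of_sq_le_sq ?_ (by positivity)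
    rw [h2, mul_pow, Real.sq_sqrt hK]
  have hd : DenseRange (Finsupp.linearCombination ℂ a) := by
    have := Finsupp.range_linearCombination ℂ (v := a)
    rw [DenseRange, ← LinearMap.coe_range, this]
    exact ha
  refine ⟨(Finsupp.linearCombination ℂ b).extendOfNorm (Finsupp.linearCombination ℂ a),
    fun i => ?_⟩
  have := LinearMap.extendOfNorm_eq (f := Finsupp.linearCombination ℂ b) hd ⟨_, hnorm⟩
    (Finsupp.single i 1)
  simpa using this

lemma exists_transformL2 {d : ℕ} {α : ℝ} (hα : -(1 / 2) < α) :
    ∃ T : L2 d α →L[ℂ] L2 d α, ∀ i, T (gaussL2 hα i) = gaussTransformL2 hα i :=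
  exists_clm_of_gram (dense_span_gaussL2 hα) (normConst_pos d hα).le (inner_gaussTransformL2 hα)

/-- The Weinstein transform as a bounded operator on `L²_α`. -/
def transformL2 {d : ℕ} {α : ℝ} (hα : -(1 / 2) < α) : L2 d α →L[ℂ] L2 d α :=
  (exists_transformL2 hα).choose

lemma transformL2_gaussL2 {d : ℕ} {α : ℝ} (hα : -(1 / 2) < α) (i : GaussIndex d) :
    transformL2 hα (gaussL2 hα i) = gaussTransformL2 hα i :=
  (exists_transformL2 hα).choose_spec i

/-- Sesquilinear identities between bounded operators on `L²_α` may be checked on Gaussians. -/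
lemma inner_map_eq_of_gauss {d : ℕ} {α : ℝ} (hα : -(1 / 2) < α) {H H' : Type*}
    [NormedAddCommGroup H] [InnerProductSpace ℂ H] [NormedAddCommGroup H'] [InnerProductSpace ℂ H']
    {A B : L2 d α →L[ℂ] H} {A' B' : L2 d α →L[ℂ] H'}
    (h : ∀ i j, inner ℂ (A (gaussL2 hα i)) (B (gaussL2 hα j)) =
      inner ℂ (A' (gaussL2 hα i)) (B' (gaussL2 hα j))) (f g : L2 d α) :
    inner ℂ (A f) (B g) = inner ℂ (A' f) (B' g) := by
  have h1 : ∀ i, inner ℂ (A (gaussL2 hα i)) (B g) = inner ℂ (A' (gaussL2 hα i)) (B' g) := by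
    intro i
    have e : (innerSL ℂ (A (gaussL2 hα i))).comp B = (innerSL ℂ (A' (gaussL2 hα i))).comp B' :=
      ContinuousLinearMap.ext_on (dense_span_gaussL2 hα) (by
        rintro _ ⟨j, rfl⟩
        exact h i j)
    exact DFunLike.congr_fun e g
  have e : (innerSL ℂ (B g)).comp A = (innerSL ℂ (B' g)).comp A' :=
    ContinuousLinearMap.ext_on (dense_span_gaussL2 hα) (by
      rintro _ ⟨i, rfl⟩
      have := congrArg conj (h1 i)
      rwa [inner_conj_symm, inner_conj_symm] at this)
  have := congrArg conj (DFunLike.congr_fun e f)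
  change conj (inner ℂ (B g) (A f)) = conj (inner ℂ (B' g) (A' f)) at this
  rwa [inner_conj_symm, inner_conj_symm] at this

lemma inner_transformL2 {d : ℕ} {α : ℝ} (hα : -(1 / 2) < α) (f g : L2 d α) :
    inner ℂ (transformL2 hα f) (transformL2 hα g) = (normConst d α : ℂ) * inner ℂ f g := by
  have h := inner_map_eq_of_gauss hα (A := transformL2 hα) (B := transformL2 hα)
    (A' := ContinuousLinearMap.id ℂ _) (B' := (normConst d α : ℂ) • ContinuousLinearMap.id ℂ _)
    (fun i j => by
      rw [transformL2_gaussL2, transformL2_gaussL2, inner_gaussTransformL2]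
      exact (inner_smul_right _ _ _).symm) f g
  exact h.trans (inner_smul_right _ _ _)

lemma aestronglyMeasurable_mul_kernel {d : ℕ} {α : ℝ} (hα : -(1 / 2) < α) {v : Space d → ℂ}
    {m m' : Measure (Space d)} [SFinite m] [SFinite m'] (hv : AEStronglyMeasurable v m) :
    AEStronglyMeasurable (fun p : Space d × Space d => v p.2 * kernel α p.2 p.1) (m'.prod m) :=
  (hv.comp_snd).mul ((measurable_kernel hα).comp measurable_swap).aestronglyMeasurable

lemma aestronglyMeasurable_fourierIntegral {d : ℕ} {α : ℝ} (hα : -(1 / 2) < α) {v : Space d → ℂ}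
    (hv : AEStronglyMeasurable v (μ d α)) :
    AEStronglyMeasurable (fourierIntegral α v) (μ d α) :=
  (aestronglyMeasurable_mul_kernel (m' := μ d α) hα hv).integral_prod_right'

lemma norm_fourierIntegral_le {d : ℕ} {α : ℝ} (hα : -(1 / 2) < α) {v : Space d → ℂ}
    (hv : Integrable v (μ d α)) (ξ : Space d) :
    ‖fourierIntegral α v ξ‖ ≤ ∫ x, ‖v x‖ ∂(μ d α) := by
  refine norm_integral_le_of_norm_le hv.norm (ae_of_all _ fun x => ?_)
  rw [norm_mul]
  exact mul_le_of_le_one_right (norm_nonneg _) (norm_kernel_le hα _ _)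

lemma integral_fourierIntegral_mul {d : ℕ} {α : ℝ} (hα : -(1 / 2) < α) {v w : Space d → ℂ}
    (hv : Integrable v (μ d α)) (hw : Integrable w (μ d α)) :
    ∫ ξ, fourierIntegral α v ξ * w ξ ∂(μ d α) = ∫ x, v x * fourierIntegral α w x ∂(μ d α) := by
  simp only [fourierIntegral, ← integral_const_mul, ← integral_mul_const]
  rw [integral_integral_swap]
  · refine integral_congr_ae (ae_of_all _ fun x => ?_)
    dsimp only
    refine integral_congr_ae (ae_of_all _ fun ξ => ?_)
    dsimp only
    rw [kernel_comm α x ξ]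
    ring
  · have h : Integrable (fun p : Space d × Space d => w p.1 * v p.2) ((μ d α).prod (μ d α)) :=
      hw.mul_prod hv
    refine h.mono ((aestronglyMeasurable_mul_kernel hα hv.1).mul hw.1.comp_fst)
      (ae_of_all _ fun p => ?_)
    simp only [Function.uncurry, norm_mul]
    have := norm_kernel_le hα p.2 p.1
    calc ‖v p.2‖ * ‖kernel α p.2 p.1‖ * ‖w p.1‖ ≤ ‖v p.2‖ * 1 * ‖w p.1‖ := by gcongr
      _ = ‖w p.1‖ * ‖v p.2‖ := by ring

/-- Both sides are continuous linear functionals of f. On Gaussians they agree by Fubini and the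
symmetry of the kernel. -/
lemma integral_mul_fourierIntegral_gauss {d : ℕ} {α : ℝ} (hα : -(1 / 2) < α) (f : L2 d α)
    (b : EuclideanSpace ℝ (Fin d)) {s : ℝ} (hs : 0 < s) :
    ∫ ξ, transformL2 hα f ξ * gauss b s ξ ∂(μ d α) =
      ∫ x, f x * fourierIntegral α (gauss b s) x ∂(μ d α) := by
  have hc : MemLp (fun x => conj (fourierIntegral α (gauss b s) x)) 2 (μ d α) :=
    (memLp_fourierIntegral_gauss hα b hs).star
  have e : (innerSL ℂ (gaussL2 hα (-b, ⟨s, hs⟩))).comp (transformL2 hα) =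
      innerSL ℂ (hc.toLp) := ContinuousLinearMap.ext_on (dense_span_gaussL2 hα) (by
    rintro _ ⟨j, rfl⟩
    change inner ℂ (gaussL2 hα (-b, ⟨s, hs⟩)) (transformL2 hα (gaussL2 hα j)) =
      inner ℂ (hc.toLp) (gaussL2 hα j)
    rw [transformL2_gaussL2, gaussL2, gaussL2, gaussTransformL2, inner_toLp_toLp, inner_toLp_toLp]
    simp only [conj_gauss, neg_neg, Complex.conj_conj]
    exact integral_fourierIntegral_mul hα (integrable_gauss hα j.1 j.2.2)
      (integrable_gauss hα b hs))
  have h := DFunLike.congr_fun e f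
  change inner ℂ (gaussL2 hα (-b, ⟨s, hs⟩)) (transformL2 hα f) = inner ℂ (hc.toLp) f at h
  rw [gaussL2, inner_toLp_left, inner_toLp_left] at h
  simpa only [conj_gauss, neg_neg, Complex.conj_conj] using h

/-- On `L¹_α ∩ L²_α` the operator `transformL2` is given by the integral. -/
theorem transformL2_toLp_ae_eq {d : ℕ} {α : ℝ} (hα : -(1 / 2) < α) {v : Space d → ℂ}
    (h1 : Integrable v (μ d α)) (h2 : MemLp v 2 (μ d α)) :
    fourierIntegral α v =ᵐ[μ d α] transformL2 hα h2.toLp := by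
  set T := transformL2 hα h2.toLp with hT
  have hiF : ∀ b (s : ℝ), 0 < s →
      Integrable (fun x => fourierIntegral α v x * gauss b s x) (μ d α) := fun b s hs =>
    (integrable_gauss hα b hs).bdd_mul (aestronglyMeasurable_fourierIntegral hα h1.1)
      (ae_of_all _ (norm_fourierIntegral_le hα h1))
  have hiT : ∀ b (s : ℝ), 0 < s → Integrable (fun x => T x * gauss b s x) (μ d α) :=
    fun b s hs => integrable_mul_gauss_of_memLp hα (Lp.memLp T) b hs
  -- Against a Gaussian, each side moves the transform onto the Gaussian: the integral by Fubini,
  -- the operator by the preceding duality.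
  have h0 : (fun x => fourierIntegral α v x - T x) =ᵐ[μ d α] 0 := by
    refine ae_eq_zero_of_integral_gauss (ae_mem_halfSpace d α)
      ((aestronglyMeasurable_fourierIntegral hα h1.1).sub (Lp.memLp T).1) ?_ ?_
    · intro s hs
      simp_rw [sub_mul]
      exact (hiF 0 s hs).sub (hiT 0 s hs)
    · intro b s hs
      simp_rw [sub_mul]
      rw [integral_sub (hiF b s hs) (hiT b s hs), hT, integral_mul_fourierIntegral_gauss hα _ b hs,
        integral_fourierIntegral_mul hα h1 (integrable_gauss hα b hs), sub_eq_zero]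
      refine integral_congr_ae ?_
      filter_upwards [h2.coeFn_toLp] with x hx
      rw [hx]
  filter_upwards [h0] with x hx
  exact sub_eq_zero.1 hx

lemma memLp_fourierIntegral {d : ℕ} {α : ℝ} (hα : -(1 / 2) < α) {v : Space d → ℂ}
    (h1 : Integrable v (μ d α)) (h2 : MemLp v 2 (μ d α)) :
    MemLp (fourierIntegral α v) 2 (μ d α) :=
  (memLp_congr_ae (transformL2_toLp_ae_eq hα h1 h2)).2 (Lp.memLp _)

lemma transformL2_toLp {d : ℕ} {α : ℝ} (hα : -(1 / 2) < α) {v : Space d → ℂ}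
    (h1 : Integrable v (μ d α)) (h2 : MemLp v 2 (μ d α)) :
    (memLp_fourierIntegral hα h1 h2).toLp = transformL2 hα h2.toLp :=
  Lp.ext ((memLp_fourierIntegral hα h1 h2).coeFn_toLp.trans (transformL2_toLp_ae_eq hα h1 h2))

/-- The Parseval identity on `L¹_α ∩ L²_α`. -/
theorem parseval {d : ℕ} {α : ℝ} (hα : -(1 / 2) < α) {v w : Space d → ℂ}
    (hv : Integrable v (μ d α)) (hv2 : MemLp v 2 (μ d α))
    (hw : Integrable w (μ d α)) (hw2 : MemLp w 2 (μ d α)) :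
    ∫ ξ, fourierIntegral α v ξ * conj (fourierIntegral α w ξ) ∂(μ d α) =
      (normConst d α : ℂ) * ∫ x, v x * conj (w x) ∂(μ d α) := by
  have h := inner_transformL2 hα hw2.toLp hv2.toLp
  rwa [← transformL2_toLp hα hw hw2, ← transformL2_toLp hα hv hv2, inner_toLp_toLp,
    inner_toLp_toLp] at h

/-- Limits in L² are unique and the operator is continuous, so the choice of approximating sequence,
and of representative in `transform`, is immaterial almost everywhere. -/
lemma IsTransform.transformL2_eq {d : ℕ} {α : ℝ} (hα : -(1 / 2) < α) {u h : Space d → ℂ}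
    (H : IsTransform α u h) : transformL2 hα H.1.toLp = H.2.1.toLp := by
  obtain ⟨hu, hh, v, hv, hvu, hvh⟩ := H
  have hv1 : ∀ n, Integrable (v n) (μ d α) := fun n => memLp_one_iff_integrable.1 (hv n).1
  have a := (Lp.tendsto_Lp_iff_tendsto_eLpNorm'' v (fun n => (hv n).2) u hu).2 hvu
  have b := (Lp.tendsto_Lp_iff_tendsto_eLpNorm'' (fun n => fourierIntegral α (v n))
    (fun n => memLp_fourierIntegral hα (hv1 n) (hv n).2) h hh).2 hvh
  simp_rw [transformL2_toLp hα (hv1 _) (hv _).2] at b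
  exact tendsto_nhds_unique (((transformL2 hα).continuous.tendsto _).comp a) b

lemma isTransform_transformL2 {d : ℕ} {α : ℝ} (hα : -(1 / 2) < α) {u : Space d → ℂ}
    (hu : MemLp u 2 (μ d α)) : IsTransform α u (transformL2 hα hu.toLp) := by
  have hex : ∀ n : ℕ, ∃ g : SimpleFunc (Space d) ℂ,
      eLpNorm (u - ⇑g) 2 (μ d α) < ((n : ENNReal) + 1)⁻¹ ∧ MemLp g 2 (μ d α) := fun n =>
    hu.exists_simpleFunc_eLpNorm_sub_lt (by simp) (by simp)
  choose g hg hg2 using hex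
  have hg1 : ∀ n, Integrable (g n) (μ d α) := fun n =>
    (SimpleFunc.memLp_iff_integrable (by simp) (by simp)).1 (hg2 n)
  have hlim : Tendsto (fun n => eLpNorm (⇑(g n) - u) 2 (μ d α)) atTop (𝓝 0) := by
    have h0 : Tendsto (fun n : ℕ => ((n : ENNReal) + 1)⁻¹) atTop (𝓝 0) := by
      have := (tendsto_add_atTop_iff_nat 1).2 ENNReal.tendsto_inv_nat_nhds_zero
      simpa using this
    refine tendsto_of_tendsto_of_tendsto_of_le_of_le tendsto_const_nhds h0 (fun _ => bot_le)
      fun n => ?_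
    rw [eLpNorm_sub_comm]
    exact (hg n).le
  refine ⟨hu, Lp.memLp _, fun n => g n, fun n =>
    ⟨memLp_one_iff_integrable.2 (hg1 n), hg2 n⟩, hlim, ?_⟩
  have a := (Lp.tendsto_Lp_iff_tendsto_eLpNorm'' (fun n => g n) hg2 u hu).2 hlim
  have b := ((transformL2 hα).continuous.tendsto _).comp a
  refine (Lp.tendsto_Lp_iff_tendsto_eLpNorm'' (fun n => fourierIntegral α (g n))
    (fun n => memLp_fourierIntegral hα (hg1 n) (hg2 n)) (transformL2 hα hu.toLp)
    (Lp.memLp (transformL2 hα hu.toLp))).1 ?_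
  rw [Lp.toLp_coeFn]
  simp_rw [transformL2_toLp hα (hg1 _) (hg2 _)]
  exact b

lemma isTransform_transform {d : ℕ} {α : ℝ} (hα : -(1 / 2) < α) {u : Space d → ℂ}
    (hu : MemLp u 2 (μ d α)) : IsTransform α u (transform α u) := by
  have h : ∃ h, IsTransform α u h := ⟨_, isTransform_transformL2 hα hu⟩
  rw [transform, dif_pos h]
  exact h.choose_spec

lemma IsTransform.ae_eq {d : ℕ} {α : ℝ} (hα : -(1 / 2) < α) {u h : Space d → ℂ}
    (H : IsTransform α u h) : h =ᵐ[μ d α] transformL2 hα H.1.toLp := by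
  rw [H.transformL2_eq hα]
  exact H.2.1.coeFn_toLp.symm

/-! ### Generalized translation and the convolution theorem. -/

lemma ae_angleMeasure_mem (α : ℝ) : ∀ᵐ θ ∂(angleMeasure α), θ ∈ Ioo 0 Real.pi :=
  (withDensity_absolutelyContinuous _ _).ae_le (ae_restrict_mem measurableSet_Ioo)

lemma continuous_shift_right {d : ℕ} (x : Space d) : Continuous (shift x) :=
  continuous_shift.comp (Continuous.prodMk_right x)

lemma shift_snd_pos {d : ℕ} {x : Space d} (hx : 0 < x.2) {p : Space d × ℝ} (hy : 0 < p.1.2)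
    (hθ : p.2 ∈ Ioo 0 Real.pi) : 0 < (shift x p).2 := by
  have hcos : -1 < Real.cos p.2 := by
    simpa using Real.cos_lt_cos_of_nonneg_of_le_pi hθ.1.le le_rfl hθ.2
  refine Real.sqrt_pos.2 ?_
  have h := mul_pos (mul_pos two_pos hx) hy
  nlinarith [sq_nonneg (x.2 - p.1.2), mul_pos h (by linarith : 0 < Real.cos p.2 + 1)]

/-- The generalized translation is an average over a measure-preserving map. -/
theorem measurePreserving_shift {d : ℕ} {α : ℝ} (hα : -(1 / 2) < α) {x : Space d} (hx : 0 < x.2) :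
    MeasurePreserving (shift x) ((μ d α).prod (angleMeasure α)) (μ d α) := by
  have := isProbabilityMeasure_angleMeasure hα
  have hm : Measurable (shift x) := (continuous_shift_right x).measurable
  have hae : ∀ b s, AEStronglyMeasurable (gauss (d := d) b s)
      (Measure.map (shift x) ((μ d α).prod (angleMeasure α))) := fun b s =>
    (continuous_gauss b s).aestronglyMeasurable
  refine ⟨hm, measure_ext_of_gauss ?_ (ae_mem_halfSpace d α) ?_ (integrable_gauss hα 0 one_pos)
    fun b s hs => ?_⟩
  · rw [ae_map_iff hm.aemeasurable (measurableSet_halfSpace d)]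
    filter_upwards [Measure.quasiMeasurePreserving_fst.ae (ae_mem_halfSpace d α),
      Measure.quasiMeasurePreserving_snd.ae (ae_angleMeasure_mem α)] with p h1 h2
    exact shift_snd_pos hx h1 h2
  · rw [integrable_map_measure (hae 0 1) hm.aemeasurable]
    exact integrable_gauss_comp_shift hα 0 one_pos x
  · rw [integral_map hm.aemeasurable (hae b s),
      integral_prod _ (integrable_gauss_comp_shift hα b hs x)]
    exact integral_shift_gauss hα b hs x

/-- Pulling f back along the projection and u along `shift x` are isometries into L² of the product
with the angular measure. In this form the correlation is visibly continuous in f and u. -/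
lemma integral_mul_conj_translate {d : ℕ} {α : ℝ} (hα : -(1 / 2) < α) {x : Space d} (hx : 0 < x.2)
    {f u : Space d → ℂ} (hf : MemLp f 2 (μ d α)) (hu : MemLp u 2 (μ d α))
    (hfst : MeasurePreserving Prod.fst ((μ d α).prod (angleMeasure α)) (μ d α)) :
    ∫ y, f y * conj (∫ θ, u (shift x (y, θ)) ∂(angleMeasure α)) ∂(μ d α) =
      inner ℂ (Lp.compMeasurePreservingₗᵢ ℂ (shift x) (measurePreserving_shift hα hx) hu.toLp)
        (Lp.compMeasurePreservingₗᵢ ℂ Prod.fst hfst hf.toLp) := by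
  have := isProbabilityMeasure_angleMeasure hα
  have hshift := measurePreserving_shift hα hx
  have hint : Integrable (fun p : Space d × ℝ => f p.1 * conj (u (shift x p)))
      ((μ d α).prod (angleMeasure α)) :=
    (hf.comp_measurePreserving hfst).integrable_mul (hu.comp_measurePreserving hshift).star
  simp_rw [← integral_conj, ← integral_const_mul]
  rw [← integral_prod _ hint, inner_Lp_eq]
  refine integral_congr_ae ?_
  filter_upwards [Lp.coeFn_compMeasurePreserving hu.toLp hshift,
    Lp.coeFn_compMeasurePreserving hf.toLp hfst,
    hshift.quasiMeasurePreserving.ae_eq_comp hu.coeFn_toLp,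
    hfst.quasiMeasurePreserving.ae_eq_comp hf.coeFn_toLp] with p h1 h2 h3 h4
  change _ = (Lp.compMeasurePreserving Prod.fst hfst hf.toLp) p *
    conj ((Lp.compMeasurePreserving (shift x) hshift hu.toLp) p)
  rw [h1, h2, h3, h4]
  rfl

lemma memLp_kernel {d : ℕ} {α : ℝ} (hα : -(1 / 2) < α) (x : Space d) :
    MemLp (kernel α x) ⊤ (μ d α) :=
  memLp_top_of_bound ((measurable_kernel hα).comp measurable_prodMk_left).aestronglyMeasurable 1
    (ae_of_all _ fun ξ => norm_kernel_le hα x ξ)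

/-- The convolution theorem: correlations with generalized translates, in terms of transforms. -/
theorem normConst_mul_integral_mul_conj_translate {d : ℕ} {α : ℝ} (hα : -(1 / 2) < α)
    {x : Space d} (hx : 0 < x.2) {f u : Space d → ℂ} (hf : MemLp f 2 (μ d α))
    (hu : MemLp u 2 (μ d α)) :
    (normConst d α : ℂ) *
      ∫ y, f y * conj (∫ θ, u (shift x (y, θ)) ∂(angleMeasure α)) ∂(μ d α) =
    ∫ ξ, transformL2 hα hf.toLp ξ * conj (transformL2 hα hu.toLp ξ) * kernel α x ξ ∂(μ d α) := by
  have := isProbabilityMeasure_angleMeasure hα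
  have hfst : MeasurePreserving Prod.fst ((μ d α).prod (angleMeasure α)) (μ d α) :=
    measurePreserving_fst
  -- Multiplication by the bounded kernel as an operator, so that the right side is also a
  -- sesquilinear form of bounded operators and can be checked on Gaussians.
  set M : L2 d α →L[ℂ] L2 d α :=
    (ContinuousLinearMap.mul ℂ ℂ).holderL (μ d α) ⊤ 2 2 (memLp_kernel hα x).toLp with hM
  have hMi : ∀ g h : L2 d α, inner ℂ h (M g) =
      ∫ ξ, g ξ * conj (h ξ) * kernel α x ξ ∂(μ d α) := fun g h => by
    rw [inner_Lp_eq]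
    refine integral_congr_ae ?_
    filter_upwards [(ContinuousLinearMap.mul ℂ ℂ).coeFn_holder (r := 2)
      (memLp_kernel hα x).toLp g, (memLp_kernel hα x).coeFn_toLp] with ξ h1 h2
    have h3 : M g ξ = kernel α x ξ * g ξ := by
      rw [← h2]
      exact h1
    rw [h3]
    ring
  have key := inner_map_eq_of_gauss hα
    (A := (Lp.compMeasurePreservingₗᵢ ℂ (shift x)
      (measurePreserving_shift hα hx)).toContinuousLinearMap)
    (B := (normConst d α : ℂ) • (Lp.compMeasurePreservingₗᵢ ℂ Prod.fst hfst).toContinuousLinearMap)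
    (A' := transformL2 hα) (B' := M.comp (transformL2 hα)) (fun i j => by
      rw [ContinuousLinearMap.comp_apply, hMi, smul_apply, inner_smul_right,
        transformL2_gaussL2, transformL2_gaussL2]
      refine (congrArg _ (integral_mul_conj_translate hα hx (memLp_gauss hα j.1 j.2.2)
        (memLp_gauss hα i.1 i.2.2) hfst).symm).trans ?_
      rw [normConst_mul_integral_gauss hα j.1 i.1 j.2.2 i.2.2]
      refine integral_congr_ae ?_
      filter_upwards [(memLp_fourierIntegral_gauss hα j.1 j.2.2).coeFn_toLp,
        (memLp_fourierIntegral_gauss hα i.1 i.2.2).coeFn_toLp] with ξ h1 h2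
      rw [gaussTransformL2, gaussTransformL2, h1, h2]) hu.toLp hf.toLp
  rw [ContinuousLinearMap.comp_apply, hMi, smul_apply, inner_smul_right] at key
  rw [integral_mul_conj_translate hα hx hf hu hfst]
  exact key

/-! ### Dilations. -/

/-- The homogeneous dimension of the half-space. -/
def homDim (d : ℕ) (α : ℝ) : ℝ := 2 * α + d + 2

lemma volume_isAddHaarMeasure (d : ℕ) : (volume : Measure (Space d)).IsAddHaarMeasure := by
  rw [Measure.volume_eq_prod]
  infer_instance

lemma lintegral_comp_smul (d : ℕ) (α : ℝ) {a : ℝ} (ha : 0 < a) {f : Space d → ENNReal}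
    (hf : Measurable f) :
    ∫⁻ x, f (a • x) ∂(μ d α) = ENNReal.ofReal (a ^ (-homDim d α)) * ∫⁻ x, f x ∂(μ d α) := by
  have := volume_isAddHaarMeasure d
  set c := (2 * Real.pi) ^ d * (2 : ℝ) ^ (2 * α) * Real.Gamma (α + 1) ^ 2
  set ρ : Space d → ENNReal := fun x => ENNReal.ofReal (x.2 ^ (2 * α + 1) / c) with hρ
  have hρm : Measurable ρ := by fun_prop
  have hH := measurableSet_halfSpace d
  have hμ : ∀ g : Space d → ENNReal, Measurable g → ∫⁻ x, g x ∂(μ d α) =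
      ∫⁻ x, (halfSpace d).indicator (fun x => ρ x * g x) x := fun g hg => by
    rw [lintegral_indicator hH]
    exact lintegral_withDensity_eq_lintegral_mul _ hρm hg
  have hsm : Measurable fun x : Space d => a • x := measurable_const_smul a
  set G : Space d → ENNReal := (halfSpace d).indicator (fun x => ρ x * f x) with hG
  have hGm : Measurable G := (hρm.mul hf).indicator hH
  have h1 : ∫⁻ x, G (a • x) = ENNReal.ofReal |(a ^ (d + 1))⁻¹| * ∫⁻ x, G x := by
    rw [← lintegral_map hGm hsm, Measure.map_addHaar_smul _ ha.ne', lintegral_smul_measure]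
    simp
  have h2 : ∀ x, G (a • x) = ENNReal.ofReal (a ^ (2 * α + 1)) *
      (halfSpace d).indicator (fun x => ρ x * f (a • x)) x := fun x => by
    rw [hG]
    by_cases hx : x ∈ halfSpace d
    · have hax : a • x ∈ halfSpace d := mul_pos ha hx
      have hx' : 0 < x.2 := hx
      rw [indicator_of_mem hx, indicator_of_mem hax, ← mul_assoc, hρ]
      dsimp only
      rw [← ENNReal.ofReal_mul (by positivity), Prod.smul_snd, smul_eq_mul,
        Real.mul_rpow ha.le hx'.le, mul_div_assoc]
    · have hax : a • x ∉ halfSpace d := fun h => hx ((mul_pos_iff_of_pos_left ha).1 h)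
      rw [indicator_of_notMem hx, indicator_of_notMem hax, mul_zero]
  simp_rw [h2] at h1
  have hfm : Measurable fun x => f (a • x) := hf.comp hsm
  have him : Measurable ((halfSpace d).indicator fun x => ρ x * f (a • x)) :=
    (hρm.mul hfm).indicator hH
  rw [lintegral_const_mul _ him, ← hμ _ hfm,
    ← hμ f hf] at h1
  -- Lebesgue measure on ℝ^{d+1} contributes d + 1 and the density contributes 2α + 1.
  have h3 : a ^ (-homDim d α) = a ^ (-(2 * α + 1)) * |(a ^ (d + 1))⁻¹| := by
    rw [abs_of_pos (by positivity), ← Real.rpow_natCast, ← Real.rpow_neg ha.le,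
      ← Real.rpow_add ha, homDim]
    congr 1
    push_cast
    ring
  rw [h3, ENNReal.ofReal_mul (by positivity), mul_assoc, ← h1, ← mul_assoc,
    ← ENNReal.ofReal_mul (by positivity), ← Real.rpow_add ha, neg_add_cancel, Real.rpow_zero,
    ENNReal.ofReal_one, one_mul]

lemma map_smul_μ (d : ℕ) (α : ℝ) {a : ℝ} (ha : 0 < a) :
    (μ d α).map (fun x => a • x) = ENNReal.ofReal (a ^ (-homDim d α)) • μ d α := by
  refine Measure.ext_of_lintegral _ fun f hf => ?_
  rw [lintegral_map hf (measurable_const_smul a), lintegral_comp_smul d α ha hf,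
    lintegral_smul_measure, smul_eq_mul]

lemma integral_comp_smul (d : ℕ) (α : ℝ) {a : ℝ} (ha : 0 < a) (f : Space d → ℂ) :
    ∫ x, f (a • x) ∂(μ d α) = ((a ^ (-homDim d α) : ℝ) : ℂ) * ∫ x, f x ∂(μ d α) := by
  rw [← (measurableEmbedding_const_smul₀ ha.ne').integral_map f, map_smul_μ d α ha,
    integral_smul_measure, ENNReal.toReal_ofReal (by positivity), Complex.real_smul]

lemma quasiMeasurePreserving_smul (d : ℕ) (α : ℝ) {a : ℝ} (ha : 0 < a) :
    Measure.QuasiMeasurePreserving (fun x : Space d => a • x) (μ d α) (μ d α) :=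
  ⟨measurable_const_smul a, by rw [map_smul_μ d α ha]; exact Measure.smul_absolutelyContinuous⟩

lemma eLpNorm_comp_smul {d : ℕ} (α : ℝ) {a : ℝ} (ha : 0 < a) {p : ENNReal} {f : Space d → ℂ}
    (hf : AEStronglyMeasurable f (μ d α)) :
    eLpNorm (fun x => f (a • x)) p (μ d α) =
      ENNReal.ofReal (a ^ (-homDim d α)) ^ (1 / p).toReal * eLpNorm f p (μ d α) := by
  have h0 : ENNReal.ofReal (a ^ (-homDim d α)) ≠ 0 := by
    rw [ne_eq, ENNReal.ofReal_eq_zero, not_le]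
    positivity
  have hm : AEStronglyMeasurable f ((μ d α).map fun x => a • x) := by
    rw [map_smul_μ d α ha]
    exact hf.mono_ac Measure.smul_absolutelyContinuous
  have h := eLpNorm_map_measure (p := p) hm (measurable_const_smul a).aemeasurable
  rw [map_smul_μ d α ha, eLpNorm_smul_measure_of_ne_zero h0, smul_eq_mul] at h
  exact h.symm

lemma memLp_comp_smul {d : ℕ} {α : ℝ} {a : ℝ} (ha : 0 < a) {p : ENNReal} {f : Space d → ℂ}
    (hf : MemLp f p (μ d α)) : MemLp (fun x => f (a • x)) p (μ d α) := by
  refine ⟨hf.1.comp_quasiMeasurePreserving (quasiMeasurePreserving_smul d α ha), ?_⟩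
  rw [eLpNorm_comp_smul α ha hf.1]
  exact ENNReal.mul_lt_top (ENNReal.rpow_lt_top_of_nonneg (by positivity) ENNReal.ofReal_ne_top)
    hf.2

lemma tendsto_eLpNorm_comp_smul {d : ℕ} {α : ℝ} {a : ℝ} (ha : 0 < a) {v : ℕ → Space d → ℂ}
    {u : Space d → ℂ} (hv : ∀ n, AEStronglyMeasurable (v n) (μ d α))
    (hu : AEStronglyMeasurable u (μ d α))
    (h : Tendsto (fun n => eLpNorm (v n - u) 2 (μ d α)) atTop (𝓝 0)) :
    Tendsto (fun n => eLpNorm ((fun x => v n (a • x)) - fun x => u (a • x)) 2 (μ d α))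
      atTop (𝓝 0) := by
  have e : ∀ n, eLpNorm ((fun x => v n (a • x)) - fun x => u (a • x)) 2 (μ d α) =
      ENNReal.ofReal (a ^ (-homDim d α)) ^ (1 / (2 : ENNReal)).toReal *
        eLpNorm (v n - u) 2 (μ d α) := fun n =>
    eLpNorm_comp_smul (f := v n - u) α ha ((hv n).sub hu)
  simp_rw [e]
  have := ENNReal.Tendsto.const_mul (a := ENNReal.ofReal (a ^ (-homDim d α)) ^
    (1 / (2 : ENNReal)).toReal) h (Or.inr (ENNReal.rpow_ne_top_of_nonneg (by positivity)
      ENNReal.ofReal_ne_top))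
  simpa only [mul_zero] using this

lemma dilate_eq {d : ℕ} (α a : ℝ) (φ : Space d → ℂ) :
    dilate α a φ = ((1 / a ^ homDim d α : ℝ) : ℂ) • fun x => φ (a⁻¹ • x) := rfl

lemma memLp_dilate {d : ℕ} {α : ℝ} {a : ℝ} (ha : 0 < a) {p : ENNReal} {φ : Space d → ℂ}
    (hφ : MemLp φ p (μ d α)) : MemLp (dilate α a φ) p (μ d α) := by
  have h : MemLp (fun x => φ (a⁻¹ • x)) p (μ d α) := memLp_comp_smul (inv_pos.2 ha) hφ
  rw [dilate_eq]
  exact h.const_smul _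

lemma kernel_smul_left {d : ℕ} (α a : ℝ) (x ξ : Space d) :
    kernel α (a • x) ξ = kernel α x (a • ξ) := by
  simp only [kernel, Prod.smul_fst, Prod.smul_snd, inner_smul_left, inner_smul_right, smul_eq_mul,
    conj_trivial]
  rw [mul_assoc, mul_left_comm x.2]

lemma fourierIntegral_dilate {d : ℕ} (α : ℝ) {a : ℝ} (ha : 0 < a) (v : Space d → ℂ)
    (ξ : Space d) : fourierIntegral α (dilate α a v) ξ = fourierIntegral α v (a • ξ) := by
  have h := integral_comp_smul d α (inv_pos.2 ha) fun x => v x * kernel α (a • x) ξ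
  simp only [smul_inv_smul₀ ha.ne'] at h
  have e : fourierIntegral α (dilate α a v) ξ = ((1 / a ^ homDim d α : ℝ) : ℂ) *
      ∫ x, v (a⁻¹ • x) * kernel α x ξ ∂(μ d α) := by
    rw [fourierIntegral, ← integral_const_mul]
    simp only [dilate_eq, Pi.smul_apply, smul_eq_mul, mul_assoc]
  rw [e, h, Real.inv_rpow ha.le, Real.rpow_neg ha.le, inv_inv, ← mul_assoc, ← Complex.ofReal_mul,
    one_div, inv_mul_cancel₀ (by positivity), Complex.ofReal_one, one_mul, fourierIntegral]
  simp only [kernel_smul_left]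

/-- Dilating an approximating sequence only multiplies the L² errors by constants depending on a. -/
lemma IsTransform.dilate {d : ℕ} {α : ℝ} (hα : -(1 / 2) < α) {a : ℝ} (ha : 0 < a)
    {u h : Space d → ℂ} (H : IsTransform α u h) :
    IsTransform α (dilate α a u) fun ξ => h (a • ξ) := by
  obtain ⟨hu, hh, v, hv, hvu, hvh⟩ := H
  refine ⟨memLp_dilate ha hu, memLp_comp_smul ha hh, fun n => Weinstein.dilate α a (v n),
    fun n => ⟨memLp_dilate ha (hv n).1, memLp_dilate ha (hv n).2⟩, ?_, ?_⟩
  · have h1 := tendsto_eLpNorm_comp_smul (inv_pos.2 ha) (fun n => (hv n).1.1) hu.1 hvu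
    simp_rw [dilate_eq, ← smul_sub, eLpNorm_const_smul]
    have := ENNReal.Tendsto.const_mul (a := ‖((1 / a ^ homDim d α : ℝ) : ℂ)‖ₑ) h1
      (Or.inr enorm_ne_top)
    simpa only [mul_zero] using this
  · have h1 := tendsto_eLpNorm_comp_smul ha (fun n => aestronglyMeasurable_fourierIntegral hα
      (hv n).1.1) hh.1 hvh
    have e : ∀ n, fourierIntegral α (Weinstein.dilate α a (v n)) =
        fun ξ => fourierIntegral α (v n) (a • ξ) := fun n =>
      funext (fourierIntegral_dilate α ha (v n))
    simp_rw [e]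
    exact h1

lemma transformL2_dilate_ae_eq {d : ℕ} {α : ℝ} (hα : -(1 / 2) < α) {a : ℝ} (ha : 0 < a)
    {φ : Space d → ℂ} (hφ : MemLp φ 2 (μ d α)) :
    (fun ξ => transform α φ (a • ξ)) =ᵐ[μ d α] transformL2 hα (memLp_dilate ha hφ).toLp :=
  ((isTransform_transform hα hφ).dilate hα ha).ae_eq hα

/-! ### The scale measure and Parseval in the position variable. -/

/-- The Haar measure `da / a` of the multiplicative group `(0, ∞)`. -/
def scaleMeasure : Measure ℝ :=
  (volume.restrict (Ioi 0)).withDensity fun a => ENNReal.ofReal (1 / a)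

instance : SigmaFinite scaleMeasure := by
  unfold scaleMeasure; infer_instance

lemma ae_scaleMeasure_pos : ∀ᵐ a ∂scaleMeasure, 0 < a :=
  (withDensity_absolutelyContinuous _ _).ae_le (ae_restrict_mem measurableSet_Ioi)

lemma integral_scaleMeasure (f : ℝ → ℂ) :
    ∫ a, f a ∂scaleMeasure = ∫ a in Ioi (0 : ℝ), f a / (a : ℂ) := by
  rw [scaleMeasure, integral_withDensity_eq_integral_toReal_smul (by fun_prop) (by simp)]
  refine setIntegral_congr_fun measurableSet_Ioi fun a ha => ?_
  have ha : 0 < a := ha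
  rw [ENNReal.toReal_ofReal (by positivity), Complex.real_smul]
  push_cast
  ring

lemma lintegral_scaleMeasure (f : ℝ → ENNReal) :
    ∫⁻ a, f a ∂scaleMeasure = ∫⁻ a in Ioi (0 : ℝ), ENNReal.ofReal (1 / a) * f a :=
  lintegral_withDensity_eq_lintegral_mul_non_measurable _ (by fun_prop) (by simp) f

/-- Needed because `transform α φ` is only almost everywhere strongly measurable: this makes (a, ξ)
↦ Fφ(aξ) so on the product. -/
lemma quasiMeasurePreserving_smul_prod (d : ℕ) (α : ℝ) :
    Measure.QuasiMeasurePreserving (fun p : ℝ × Space d => p.1 • p.2)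
      (scaleMeasure.prod (μ d α)) (μ d α) := by
  have hm : Measurable fun p : ℝ × Space d => p.1 • p.2 := by fun_prop
  refine ⟨hm, Measure.AbsolutelyContinuous.mk fun s hs h0 => ?_⟩
  rw [Measure.map_apply hm hs, Measure.measure_prod_null (hm hs)]
  filter_upwards [ae_scaleMeasure_pos] with a ha
  exact (quasiMeasurePreserving_smul d α ha).preimage_null h0

lemma integrable_norm_sq_of_memLp {X : Type*} [MeasurableSpace X] {m : Measure X} {f : X → ℂ}
    (hf : MemLp f 2 m) : Integrable (fun x => ‖f x‖ ^ 2) m :=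
  (memLp_two_iff_integrable_sq_norm hf.1).1 hf

lemma ofReal_norm_sq_eq_mul_conj (z : ℂ) : ((‖z‖ ^ 2 : ℝ) : ℂ) = z * conj z := by
  rw [Complex.mul_conj, Complex.normSq_eq_norm_sq]

lemma integral_norm_sq_fourierIntegral {d : ℕ} {α : ℝ} (hα : -(1 / 2) < α) {v : Space d → ℂ}
    (h1 : Integrable v (μ d α)) (h2 : MemLp v 2 (μ d α)) :
    ∫ ξ, ‖fourierIntegral α v ξ‖ ^ 2 ∂(μ d α) = normConst d α * ∫ x, ‖v x‖ ^ 2 ∂(μ d α) := by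
  have h := parseval hα h1 h2 h1 h2
  simp_rw [← ofReal_norm_sq_eq_mul_conj] at h
  rw [integral_complex_ofReal, integral_complex_ofReal] at h
  exact_mod_cast h

section Fibrewise

variable {d : ℕ} {α : ℝ} {m : Measure ℝ} [SFinite m]

lemma ae_memLp_fibre {W : ℝ × Space d → ℂ} (hW : MemLp W 2 (m.prod (μ d α))) :
    ∀ᵐ a ∂m, MemLp (fun ξ => W (a, ξ)) 2 (μ d α) := by
  filter_upwards [(integrable_norm_sq_of_memLp hW).prod_right_ae, hW.1.prodMk_left] with a h1 h2
  exact (memLp_two_iff_integrable_sq_norm h2).2 h1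

lemma aestronglyMeasurable_fibre_fourierIntegral (hα : -(1 / 2) < α) {W : ℝ × Space d → ℂ}
    (hW : AEStronglyMeasurable W (m.prod (μ d α))) :
    AEStronglyMeasurable (fun p : ℝ × Space d => fourierIntegral α (fun ξ => W (p.1, ξ)) p.2)
      (m.prod (μ d α)) := by
  have hq : Measure.QuasiMeasurePreserving (fun q : (ℝ × Space d) × Space d => (q.1.1, q.2))
      ((m.prod (μ d α)).prod (μ d α)) (m.prod (μ d α)) :=
    MeasureTheory.QuasiMeasurePreserving.prodMap Measure.quasiMeasurePreserving_fst
      (Measure.QuasiMeasurePreserving.id (μ d α))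
  have h : AEStronglyMeasurable
      (fun q : (ℝ × Space d) × Space d => W (q.1.1, q.2) * kernel α q.2 q.1.2)
      ((m.prod (μ d α)).prod (μ d α)) := by
    refine (hW.comp_quasiMeasurePreserving hq).mul ?_
    exact ((measurable_kernel hα).comp
      (measurable_snd.prodMk (measurable_snd.comp measurable_fst))).aestronglyMeasurable
  exact h.integral_prod_right'

lemma memLp_fibre_fourierIntegral (hα : -(1 / 2) < α) {W : ℝ × Space d → ℂ}
    (hW : MemLp W 2 (m.prod (μ d α)))
    (hW1 : ∀ᵐ a ∂m, Integrable (fun ξ => W (a, ξ)) (μ d α)) :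
    MemLp (fun p : ℝ × Space d => fourierIntegral α (fun ξ => W (p.1, ξ)) p.2) 2
      (m.prod (μ d α)) := by
  have hm := aestronglyMeasurable_fibre_fourierIntegral hα hW.1
  have hm2 : AEStronglyMeasurable (fun p : ℝ × Space d =>
      ‖fourierIntegral α (fun ξ => W (p.1, ξ)) p.2‖ ^ 2) (m.prod (μ d α)) := hm.norm.pow 2
  rw [memLp_two_iff_integrable_sq_norm hm, integrable_prod_iff hm2]
  constructor
  · filter_upwards [hW1, ae_memLp_fibre hW] with a h1 h2
    exact integrable_norm_sq_of_memLp (memLp_fourierIntegral hα h1 h2)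
  · refine ((integrable_norm_sq_of_memLp hW).integral_prod_left.const_mul
      (normConst d α)).congr ?_
    filter_upwards [hW1, ae_memLp_fibre hW] with a h1 h2
    simp only [norm_pow, norm_norm]
    exact (integral_norm_sq_fourierIntegral hα h1 h2).symm

/-- The Parseval identity for functions on a product, transformed in the second variable. -/
theorem integral_fibre_fourierIntegral (hα : -(1 / 2) < α) {W W' : ℝ × Space d → ℂ}
    (hW : MemLp W 2 (m.prod (μ d α)))
    (hW1 : ∀ᵐ a ∂m, Integrable (fun ξ => W (a, ξ)) (μ d α))
    (hW' : MemLp W' 2 (m.prod (μ d α)))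
    (hW1' : ∀ᵐ a ∂m, Integrable (fun ξ => W' (a, ξ)) (μ d α)) :
    ∫ p, fourierIntegral α (fun ξ => W (p.1, ξ)) p.2 *
        conj (fourierIntegral α (fun ξ => W' (p.1, ξ)) p.2) ∂(m.prod (μ d α)) =
      (normConst d α : ℂ) * ∫ p, W p * conj (W' p) ∂(m.prod (μ d α)) := by
  have hi : Integrable (fun p : ℝ × Space d => fourierIntegral α (fun ξ => W (p.1, ξ)) p.2 *
      conj (fourierIntegral α (fun ξ => W' (p.1, ξ)) p.2)) (m.prod (μ d α)) :=
    (memLp_fibre_fourierIntegral hα hW hW1).integrable_mul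
      (memLp_fibre_fourierIntegral hα hW' hW1').star
  have hi2 : Integrable (fun p => W p * conj (W' p)) (m.prod (μ d α)) :=
    hW.integrable_mul hW'.star
  rw [integral_prod _ hi, integral_prod _ hi2, ← integral_const_mul]
  refine integral_congr_ae ?_
  filter_upwards [hW1, ae_memLp_fibre hW, hW1', ae_memLp_fibre hW'] with a h1 h2 h3 h4
  exact parseval hα h1 h2 h3 h4

end Fibrewise

/-! ### The wavelet symbol and the orthogonality relation. -/

/-- The transform in `x` of the wavelet transform of `f`, up to normalization. -/
def waveletSymbol {d : ℕ} {α : ℝ} (hα : -(1 / 2) < α) (φ : Space d → ℂ) (f : L2 d α)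
    (p : ℝ × Space d) : ℂ :=
  transformL2 hα f p.2 * conj (transform α φ (p.1 • p.2))

lemma aestronglyMeasurable_waveletSymbol {d : ℕ} {α : ℝ} (hα : -(1 / 2) < α) {φ : Space d → ℂ}
    (hφ : MemLp φ 2 (μ d α)) (f : L2 d α) :
    AEStronglyMeasurable (waveletSymbol hα φ f) (scaleMeasure.prod (μ d α)) := by
  have h1 := (isTransform_transform hα hφ).2.1.1.comp_quasiMeasurePreserving
    (quasiMeasurePreserving_smul_prod d α)
  exact (Lp.memLp (transformL2 hα f)).1.comp_snd.mul h1.star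

/-- By Tonelli the scale integral may be done first; admissibility makes it the constant C_φ,
leaving C_φ ‖Ff‖². -/
lemma memLp_waveletSymbol {d : ℕ} {α : ℝ} (hα : -(1 / 2) < α) {φ : Space d → ℂ}
    (hφ : IsWavelet α φ) (f : L2 d α) :
    MemLp (waveletSymbol hα φ f) 2 (scaleMeasure.prod (μ d α)) := by
  obtain ⟨hφ2, C, -, hC⟩ := hφ
  have hm := aestronglyMeasurable_waveletSymbol hα hφ2 f
  have hm2 : AEStronglyMeasurable (fun p => ‖waveletSymbol hα φ f p‖ ^ 2)
      (scaleMeasure.prod (μ d α)) := hm.norm.pow 2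
  rw [memLp_two_iff_integrable_sq_norm hm]
  refine ⟨hm2, ?_⟩
  rw [hasFiniteIntegral_iff_ofReal (ae_of_all _ fun p => by positivity),
    lintegral_prod_symm _ hm2.aemeasurable.ennreal_ofReal]
  have e : ∀ᵐ ξ ∂(μ d α), ∫⁻ a, ENNReal.ofReal (‖waveletSymbol hα φ f (a, ξ)‖ ^ 2)
      ∂scaleMeasure = ENNReal.ofReal (‖transformL2 hα f ξ‖ ^ 2) * ENNReal.ofReal C := by
    filter_upwards [hC] with ξ hξ
    rw [← hξ, lintegral_scaleMeasure, ← lintegral_const_mul' _ _ ENNReal.ofReal_ne_top]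
    refine setLIntegral_congr_fun measurableSet_Ioi fun a ha => ?_
    have ha : 0 < a := ha
    rw [← ENNReal.ofReal_mul (by positivity), ← ENNReal.ofReal_mul (by positivity), waveletSymbol,
      norm_mul, RCLike.norm_conj]
    congr 1
    ring
  rw [lintegral_congr_ae e, lintegral_mul_const' _ _ ENNReal.ofReal_ne_top]
  refine ENNReal.mul_lt_top ?_ ENNReal.ofReal_lt_top
  have := (integrable_norm_sq_of_memLp (Lp.memLp (transformL2 hα f))).2
  rwa [hasFiniteIntegral_iff_ofReal (ae_of_all _ fun p => by positivity)] at this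

lemma ae_integrable_waveletSymbol {d : ℕ} {α : ℝ} (hα : -(1 / 2) < α) {φ : Space d → ℂ}
    (hφ : MemLp φ 2 (μ d α)) (f : L2 d α) :
    ∀ᵐ a ∂scaleMeasure, Integrable (fun ξ => waveletSymbol hα φ f (a, ξ)) (μ d α) := by
  filter_upwards [ae_scaleMeasure_pos] with a ha
  exact (Lp.memLp (transformL2 hα f)).integrable_mul
    (memLp_comp_smul ha (isTransform_transform hα hφ).2.1).star

lemma integral_waveletSymbol_mul_conj {d : ℕ} {α : ℝ} (hα : -(1 / 2) < α) {φ ψ : Space d → ℂ}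
    {C : ℂ} (hφ : IsWavelet α φ) (hψ : IsWavelet α ψ) (h : IsTwoWavelet α φ ψ C) (f g : L2 d α) :
    ∫ p, waveletSymbol hα φ f p * conj (waveletSymbol hα ψ g p) ∂(scaleMeasure.prod (μ d α)) =
      C * ((normConst d α : ℂ) * inner ℂ g f) := by
  have hi : Integrable (fun p => waveletSymbol hα φ f p * conj (waveletSymbol hα ψ g p))
      (scaleMeasure.prod (μ d α)) :=
    (memLp_waveletSymbol hα hφ f).integrable_mul (memLp_waveletSymbol hα hψ g).star
  -- With the scale integral innermost, the two-wavelet condition evaluates it to C for almost every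
  -- ξ.
  rw [integral_prod_symm _ hi, ← inner_transformL2 hα, inner_Lp_eq, ← integral_const_mul]
  refine integral_congr_ae ?_
  filter_upwards [h.2.2] with ξ hξ
  rw [integral_scaleMeasure, ← hξ.2, mul_comm, ← integral_const_mul]
  refine integral_congr_ae (ae_of_all _ fun a => ?_)
  simp only [waveletSymbol, map_mul, Complex.conj_conj]
  ring

/-- The wavelet transform as a Weinstein transform in the position variable. -/
theorem waveletTransform_eq {d : ℕ} {α : ℝ} (hα : -(1 / 2) < α) {φ f : Space d → ℂ}
    (hφ : MemLp φ 2 (μ d α)) (hf : MemLp f 2 (μ d α)) {a : ℝ} (ha : 0 < a) {x : Space d}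
    (hx : 0 < x.2) :
    waveletTransform α φ f (a, x) = ((a ^ (homDim d α / 2) / normConst d α : ℝ) : ℂ) *
      fourierIntegral α (fun ξ => waveletSymbol hα φ hf.toLp (a, ξ)) x := by
  have hK : (normConst d α : ℂ) ≠ 0 := Complex.ofReal_ne_zero.2 (normConst_pos d hα).ne'
  have h1 := normConst_mul_integral_mul_conj_translate hα hx hf (memLp_dilate ha hφ)
  have h2 : fourierIntegral α (fun ξ => waveletSymbol hα φ hf.toLp (a, ξ)) x =
      ∫ ξ, transformL2 hα hf.toLp ξ * conj (transformL2 hα (memLp_dilate ha hφ).toLp ξ) *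
        kernel α x ξ ∂(μ d α) := by
    rw [fourierIntegral]
    refine integral_congr_ae ?_
    filter_upwards [transformL2_dilate_ae_eq hα ha hφ] with ξ hξ
    rw [← hξ, kernel_comm, waveletSymbol]
  have h3 : waveletTransform α φ f (a, x) = ((a ^ (homDim d α / 2) : ℝ) : ℂ) *
      ∫ y, f y * conj (∫ θ, dilate α a φ (shift x (y, θ)) ∂(angleMeasure α)) ∂(μ d α) := by
    rw [waveletTransform, ← integral_const_mul]
    refine integral_congr_ae (ae_of_all _ fun y => ?_)
    have e : α + 1 + (d : ℝ) / 2 = homDim d α / 2 := by rw [homDim]; ring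
    dsimp only
    rw [waveletFamily, translation_eq hα, map_mul, Complex.conj_ofReal, e]
    ring
  rw [h3, h2, ← h1]
  push_cast
  field_simp

/-- Splitting off da/a isolates the weight a^{-D}, which cancels the two factors a^{D/2} of the
wavelet transforms, D being `homDim d α`. -/
lemma μX_eq_withDensity (d : ℕ) (α : ℝ) :
    μX d α = (scaleMeasure.prod (μ d α)).withDensity
      fun p => ENNReal.ofReal (p.1 ^ (-homDim d α)) := by
  have h : ((volume.restrict (Ioi (0 : ℝ))).withDensity fun a =>
      ENNReal.ofReal (1 / a ^ (2 * α + d + 3))) =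
      scaleMeasure.withDensity fun a => ENNReal.ofReal (a ^ (-homDim d α)) := by
    rw [scaleMeasure, ← withDensity_mul _ (by fun_prop) (by fun_prop)]
    refine withDensity_congr_ae ?_
    filter_upwards [ae_restrict_mem measurableSet_Ioi] with a ha
    have ha : 0 < a := ha
    rw [Pi.mul_apply, ← ENNReal.ofReal_mul (by positivity), one_div, one_div,
      ← Real.rpow_neg ha.le, ← Real.rpow_neg_one a, ← Real.rpow_add ha, homDim]
    congr 2
    ring
  rw [μX, h]
  exact prod_withDensity_left (f := fun a : ℝ => ENNReal.ofReal (a ^ (-homDim d α))) (by fun_prop)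

lemma density_smul_waveletTransform_ae_eq {d : ℕ} {α : ℝ} (hα : -(1 / 2) < α)
    {φ ψ f g : Space d → ℂ} (hφ : MemLp φ 2 (μ d α)) (hψ : MemLp ψ 2 (μ d α))
    (hf : MemLp f 2 (μ d α)) (hg : MemLp g 2 (μ d α)) :
    (fun p : ℝ × Space d => (ENNReal.ofReal (p.1 ^ (-homDim d α))).toReal •
        (waveletTransform α φ f p * conj (waveletTransform α ψ g p)))
      =ᵐ[scaleMeasure.prod (μ d α)] fun p => ((1 / normConst d α ^ 2 : ℝ) : ℂ) *
        (fourierIntegral α (fun ξ => waveletSymbol hα φ hf.toLp (p.1, ξ)) p.2 *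
          conj (fourierIntegral α (fun ξ => waveletSymbol hα ψ hg.toLp (p.1, ξ)) p.2)) := by
  filter_upwards [Measure.quasiMeasurePreserving_fst.ae ae_scaleMeasure_pos,
    Measure.quasiMeasurePreserving_snd.ae (ae_mem_halfSpace d α)] with p ha hx
  obtain ⟨a, x⟩ := p
  have ha : 0 < a := ha
  have e : a ^ (-homDim d α) * (a ^ (homDim d α / 2) / normConst d α) *
      (a ^ (homDim d α / 2) / normConst d α) = 1 / normConst d α ^ 2 := by
    have e1 : a ^ (-homDim d α) * (a ^ (homDim d α / 2) * a ^ (homDim d α / 2)) = 1 := by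
      rw [← Real.rpow_add ha, ← Real.rpow_add ha, add_halves, neg_add_cancel, Real.rpow_zero]
    rw [← e1]
    ring
  dsimp only
  rw [waveletTransform_eq hα hφ hf ha hx, waveletTransform_eq hα hψ hg ha hx,
    ENNReal.toReal_ofReal (by positivity), Complex.real_smul, ← e, map_mul, Complex.conj_ofReal,
    Complex.ofReal_mul, Complex.ofReal_mul]
  ring

end Weinstein

end

theorem theorem3p1 (d : ℕ) (α : ℝ) (hα : -(1 / 2) < α)
    (φ ψ : Weinstein.Space d → ℂ) (C : ℂ)
    (hφ : Weinstein.IsWavelet α φ) (hψ : Weinstein.IsWavelet α ψ)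
    (hφψ : Weinstein.IsTwoWavelet α φ ψ C)
    (f g : Weinstein.Space d → ℂ)
    (hf : MemLp f 2 (Weinstein.μ d α)) (hg : MemLp g 2 (Weinstein.μ d α)) :
    Integrable (fun p : ℝ × Weinstein.Space d =>
        Weinstein.waveletTransform α φ f p * conj (Weinstein.waveletTransform α ψ g p))
      (Weinstein.μX d α) ∧
    ∫ p, Weinstein.waveletTransform α φ f p * conj (Weinstein.waveletTransform α ψ g p)
        ∂(Weinstein.μX d α) =
      C * ∫ x, f x * conj (g x) ∂(Weinstein.μ d α) := by
  have hS := Weinstein.memLp_waveletSymbol hα hφ hf.toLp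
  have hS' := Weinstein.memLp_waveletSymbol hα hψ hg.toLp
  have hS1 := Weinstein.ae_integrable_waveletSymbol hα hφ.1 hf.toLp
  have hS1' := Weinstein.ae_integrable_waveletSymbol hα hψ.1 hg.toLp
  have hae := Weinstein.density_smul_waveletTransform_ae_eq hα hφ.1 hψ.1 hf hg
  rw [Weinstein.μX_eq_withDensity]
  constructor
  · rw [integrable_withDensity_iff_integrable_smul' (by fun_prop) (by simp), integrable_congr hae]
    exact ((Weinstein.memLp_fibre_fourierIntegral hα hS hS1).integrable_mul
      (Weinstein.memLp_fibre_fourierIntegral hα hS' hS1').star).const_mul _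
  · rw [integral_withDensity_eq_integral_toReal_smul (by fun_prop) (by simp),
      integral_congr_ae hae, integral_const_mul,
      Weinstein.integral_fibre_fourierIntegral hα hS hS1 hS' hS1',
      Weinstein.integral_waveletSymbol_mul_conj hα hφ hψ hφψ, Weinstein.inner_toLp_toLp]
    -- The constants are K⁻² from the two wavelet transforms and one K from each use of Parseval.
    have hK : (Weinstein.normConst d α : ℂ) ≠ 0 :=
      Complex.ofReal_ne_zero.2 (Weinstein.normConst_pos d hα).ne'
    push_cast
    field_simp
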